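/- **Proposition (Non-Abelian Moyal–Weyl plane).** Let $n,m\in\mathbb N$, let $\tau^1,\dots,\tau^{m^2-1}$ be infinitesimal generators of $SU(m)$, i.e. a basis of the real vector space of Hermitian traceless $m\times m$ matrices, and let $Y_\alpha$ ($\alpha=1,\dots,m^2-1$) be real numbers or complex $m\times m$ matrices such that $M:=\sum_\alpha Y_\alpha\tau^\alpha$ is Hermitian. Let $\Theta=(\Theta^{ij})$ be a real skew-symmetric $n\times n$ matrix. On $L^2(\mathbb R^n)\otimes\mathbb C^m$ let $X^i$ be the closure of multiplication by $x^i$ on $\mathscr S(\mathbb R^n)\otimes\mathbb C^m$, let $P_k=i\,\partial/\partial x^k$, and consider the unitary groups $$U(p)=\exp\Big(i\sum_k p^kP_k\Big)\otimes 1,\qquad U^\tau(p)=\exp\Big(i\sum_k p^k\,P_k\otimes M\Big),\qquad p\in\mathbb R^n .$$ The non-abelian warped convolution of $X^i$ with generator of deformations $Q_k=P_k\otimes Y_\alpha\tau^\alpha$ is $$X^{i,\Theta_\tau}\Phi=(2\pi)^{-n}\lim_{\epsilon\to0^+}\iint dx\,dy\;\chi(\epsilon x,\epsilon y)\,e^{-i\sum_k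 x_ky^k}\,U(y)\,U^\tau(\Theta x)\,(X^i\otimes 1)\,U^\tau(\Theta x)^{-1}\Phi,\qquad (\Theta x)^i=\sum_k\Theta^{ik}x_k,$$ where $\chi\in\mathscr S(\mathbb R^n\times\mathbb R^n)$ with $\chi(0,0)=1$; it is called well defined on $\Phi$ if the integrand makes sense and is integrable for all $\epsilon>0$ and all such $\chi$, and the limit exists in norm and does not depend on $\chi$. Then: 1. $X^{i,\Theta_\tau}$ is well defined on $\mathscr S(\mathbb R^n)\otimes\mathbb C^m$ (hence on $\mathcal E\otimes\mathbb C^m$ for every $\mathcal E\subseteq\mathscr S(\mathbb R^n)$), and there $$X^{i,\Theta_\tau}=X^i-(\Theta P)^i\otimes Y_\alpha\tau^\alpha,\qquad (\Theta P)^i=\sum_k\Theta^{ik}P_k ;$$ 2. for all $i,j$, both products $X^{i,\Theta_\tau}X^{j,\Theta_\tau}$ and $X^{j,\Theta_\tau}X^{i,\Theta_\tau}$ are defined on $\mathscr S(\mathbb R^n)\otimes\mathbb C^m$, and there $$[X^{i,\Theta_\tau},X^{j,\Theta_\tau}]=-2i\,\Theta^{ij}\otimes Y_\alpha\tau^\alpha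 .$$ -/

import Mathlib

open MeasureTheory Filter Topology
open scoped SchwartzMap FourierTransform LineDeriv

noncomputable section

namespace MoyalWeyl

/-- The real vector space `ℝⁿ`, with its Euclidean structure. -/
abbrev Pos (n : ℕ) := EuclideanSpace ℝ (Fin n)

/-- The Hilbert space `ℂᵐ`. -/
abbrev Col (m : ℕ) := EuclideanSpace ℂ (Fin m)

/-- The Hilbert space `L²(ℝⁿ) ⊗ ℂᵐ`, realised as `L²(ℝⁿ; ℂᵐ)`. -/
abbrev Hilb (n m : ℕ) := Lp (Col m) 2 (volume : Measure (Pos n))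

/-! ### The generators of `SU(m)` -/

/-- `τ_1, …, τ_{m²-1}` are infinitesimal generators of `SU(m)` (in the physicists' convention):
they form a basis of the real vector space, of dimension `m² - 1`, of Hermitian traceless
`m × m` matrices. In particular, `[τ_α, τ_β] = i ∑_γ f_{αβγ} τ_γ` for some structure constants. -/
structure IsSUGenerators {m : ℕ} (τ : Fin (m ^ 2 - 1) → Matrix (Fin m) (Fin m) ℂ) : Prop where
  isHermitian : ∀ α, (τ α).IsHermitian
  trace_eq_zero : ∀ α, (τ α).trace = 0
  linearIndependent : LinearIndependent ℝ τ

/-- A Hermitian matrix as a self-adjoint operator on `ℂᵐ`. -/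
def hermitianOp {m : ℕ} (M : Matrix (Fin m) (Fin m) ℂ) (hM : M.IsHermitian) :
    selfAdjoint (Col m →L[ℂ] Col m) :=
  ⟨Matrix.toEuclideanCLM (n := Fin m) (𝕜 := ℂ) M, by
    rw [selfAdjoint.mem_iff, ← map_star]
    exact congrArg _ hM⟩

/-! ### Operators on Schwartz functions and their closures -/

section Schwartz

variable {n m : ℕ}

/-- The coordinate operator `X^i ⊗ 1` on `𝓢(ℝⁿ) ⊗ ℂᵐ`: multiplication by `x^i`. -/
def coordS (i : Fin n) : 𝓢(Pos n, Col m) →L[ℂ] 𝓢(Pos n, Col m) :=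
  SchwartzMap.smulLeftCLM (Col m) (fun x : Pos n => ((x i : ℝ) : ℂ))

theorem coordS_apply (i : Fin n) (Φ : 𝓢(Pos n, Col m)) (x : Pos n) :
    coordS i Φ x = ((x i : ℝ) : ℂ) • Φ x := by
  refine SchwartzMap.smulLeftCLM_apply_apply ?_ Φ x
  exact (Complex.ofRealCLM ∘L (EuclideanSpace.proj i : Pos n →L[ℝ] ℝ)).hasTemperateGrowth

/-- The momentum operator `P_k ⊗ 1` on `𝓢(ℝⁿ) ⊗ ℂᵐ`, where `P_k = i ∂/∂x^k`. -/
def momS (k : Fin n) : 𝓢(Pos n, Col m) →L[ℂ] 𝓢(Pos n, Col m) :=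
  Complex.I • LineDeriv.lineDerivOpCLM ℂ 𝓢(Pos n, Col m) (EuclideanSpace.single k (1 : ℝ))

/-- The operator `1 ⊗ M` on `𝓢(ℝⁿ) ⊗ ℂᵐ`. -/
def matS (M : Matrix (Fin m) (Fin m) ℂ) : 𝓢(Pos n, Col m) →L[ℂ] 𝓢(Pos n, Col m) :=
  SchwartzMap.postcompCLM (Matrix.toEuclideanCLM (n := Fin m) (𝕜 := ℂ) M)

/-- The inclusion `𝓢(ℝⁿ) ⊗ ℂᵐ ⊆ L²(ℝⁿ) ⊗ ℂᵐ`. -/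
def incl : 𝓢(Pos n, Col m) →ₗ[ℂ] Hilb n m :=
  (SchwartzMap.toLpCLM ℂ (Col m) 2 (volume : Measure (Pos n))).toLinearMap

theorem incl_injective : Function.Injective (incl (n := n) (m := m)) :=
  SchwartzMap.injective_toLp 2 volume

/-- An operator on Schwartz functions, as an unbounded operator on `L²(ℝⁿ) ⊗ ℂᵐ` with domain
`𝓢(ℝⁿ) ⊗ ℂᵐ`. -/
def schwartzOp (T : 𝓢(Pos n, Col m) →L[ℂ] 𝓢(Pos n, Col m)) : Hilb n m →ₗ.[ℂ] Hilb n m where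
  domain := LinearMap.range incl
  toFun := incl ∘ₗ T.toLinearMap ∘ₗ (LinearEquiv.ofInjective incl incl_injective).symm.toLinearMap

/-- The coordinate operator `X^i ⊗ 1`: the closure of multiplication by `x^i` on Schwartz
functions. -/
def coordinate (i : Fin n) : Hilb n m →ₗ.[ℂ] Hilb n m :=
  (schwartzOp (coordS i)).closure

end Schwartz

/-! ### The unitary group generated by `P_k ⊗ M` -/

section Group

variable {n m : ℕ}

/-- The value at frequency `ξ` of the Fourier multiplier of `exp(i p^k P_k ⊗ M)`. With the
convention `𝓕 f ξ = ∫ exp(-2πi ⟨x, ξ⟩) f x dx`, the operator `P_k = i ∂/∂x^k` is multiplication by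
`-2π ξ_k` on the Fourier side, so that the value is the unitary matrix
`exp(i (-2π ∑_k p^k ξ_k) M)`. -/
def groupSymbol (M : selfAdjoint (Col m →L[ℂ] Col m)) (p ξ : Pos n) :
    unitary (Col m →L[ℂ] Col m) :=
  selfAdjoint.expUnitary ⟨((-(2 * Real.pi * ∑ k, p k * ξ k) : ℝ) : ℂ) • (M : Col m →L[ℂ] Col m),
    IsSelfAdjoint.smul (Complex.conj_ofReal _) M.2⟩

theorem continuous_groupSymbol (M : selfAdjoint (Col m →L[ℂ] Col m)) (p : Pos n) :
    Continuous (groupSymbol M p) := by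
  unfold groupSymbol
  refine selfAdjoint.continuous_expUnitary.comp (Continuous.subtype_mk ?_ _)
  have h : Continuous fun ξ : Pos n => ((-(2 * Real.pi * ∑ k, p k * ξ k) : ℝ) : ℂ) := by fun_prop
  exact h.smul continuous_const

theorem continuous_inv_unitary {u : Pos n → unitary (Col m →L[ℂ] Col m)} (hu : Continuous u) :
    Continuous fun ξ => (u ξ)⁻¹ :=
  Continuous.subtype_mk ((ContinuousLinearMap.adjoint (𝕜 := ℂ) (E := Col m) (F := Col m)).continuous.comp
    (continuous_subtype_val.comp hu)) _

theorem norm_unitary_apply (u : unitary (Col m →L[ℂ] Col m)) (v : Col m) :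
    ‖(u : Col m →L[ℂ] Col m) v‖ = ‖v‖ :=
  (Unitary.linearIsometryEquiv u).norm_map v

/-- Pointwise application of a continuous unitary-matrix-valued function to an `L²` function. -/
theorem memLp_unitary {u : Pos n → unitary (Col m →L[ℂ] Col m)} (hu : Continuous u)
    (f : Hilb n m) : MemLp (fun ξ => (u ξ : Col m →L[ℂ] Col m) (f ξ)) 2 volume := by
  refine (Lp.memLp f).of_le ?_ (Eventually.of_forall fun ξ => (norm_unitary_apply _ _).le)
  have h1 : Continuous fun ξ => (u ξ : Col m →L[ℂ] Col m) := continuous_subtype_val.comp hu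
  exact (ContinuousLinearMap.id ℂ (Col m →L[ℂ] Col m)).aestronglyMeasurable_comp₂
    h1.aestronglyMeasurable (Lp.aestronglyMeasurable f)

/-- Multiplication by a continuous function with values in the unitary matrices, as a linear
isometry of `L²(ℝⁿ; ℂᵐ)`. -/
def unitaryMul (u : Pos n → unitary (Col m →L[ℂ] Col m)) (hu : Continuous u) :
    Hilb n m →ₗᵢ[ℂ] Hilb n m where
  toFun f := (memLp_unitary hu f).toLp _
  map_add' f g := by
    apply Lp.ext
    filter_upwards [(memLp_unitary hu (f + g)).coeFn_toLp, (memLp_unitary hu f).coeFn_toLp,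
      (memLp_unitary hu g).coeFn_toLp, Lp.coeFn_add f g,
      Lp.coeFn_add ((memLp_unitary hu f).toLp _) ((memLp_unitary hu g).toLp _)] with ξ h1 h2 h3 h4 h5
    rw [h1, h5, Pi.add_apply, h2, h3, h4, Pi.add_apply, map_add]
  map_smul' c f := by
    apply Lp.ext
    filter_upwards [(memLp_unitary hu (c • f)).coeFn_toLp, (memLp_unitary hu f).coeFn_toLp,
      Lp.coeFn_smul c f, Lp.coeFn_smul c ((memLp_unitary hu f).toLp _)] with ξ h1 h2 h4 h5
    rw [h1, RingHom.id_apply, h5, Pi.smul_apply, h2, h4, Pi.smul_apply, map_smul]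
  norm_map' f := by
    change ‖(memLp_unitary hu f).toLp _‖ = ‖f‖
    rw [Lp.norm_toLp, Lp.norm_def]
    congr 1
    exact eLpNorm_congr_norm_ae (Eventually.of_forall fun ξ => norm_unitary_apply _ _)

theorem unitaryMul_inv (u : Pos n → unitary (Col m →L[ℂ] Col m)) (hu : Continuous u)
    (f : Hilb n m) : unitaryMul u hu (unitaryMul (fun ξ => (u ξ)⁻¹) (continuous_inv_unitary hu) f) = f := by
  apply Lp.ext
  have h1 := (memLp_unitary hu (unitaryMul (fun ξ => (u ξ)⁻¹) (continuous_inv_unitary hu) f)).coeFn_toLp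
  have h2 := (memLp_unitary (continuous_inv_unitary hu) f).coeFn_toLp
  filter_upwards [h1, h2] with ξ h1 h2
  change ((memLp_unitary hu (unitaryMul (fun ξ => (u ξ)⁻¹) (continuous_inv_unitary hu) f)).toLp _) ξ = _
  rw [h1]
  change (u ξ : Col m →L[ℂ] Col m) (((memLp_unitary (continuous_inv_unitary hu) f).toLp _) ξ) = _
  rw [h2, ← mul_apply_eq_comp, ← Submonoid.coe_mul]
  simp

/-- The unitary operator `exp(i p^k P_k ⊗ M)` on `L²(ℝⁿ) ⊗ ℂᵐ`, i.e. the function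
`π ↦ exp(i p^k π_k M)` of the momentum operator. -/
def momentumGroup (M : selfAdjoint (Col m →L[ℂ] Col m)) (p : Pos n) :
    Hilb n m ≃ₗᵢ[ℂ] Hilb n m :=
  (Lp.fourierTransformₗᵢ (Pos n) (Col m)).trans
    ((LinearIsometryEquiv.ofSurjective
      (unitaryMul (groupSymbol M p) (continuous_groupSymbol M p))
      (fun f => ⟨_, unitaryMul_inv (groupSymbol M p) (continuous_groupSymbol M p) f⟩)).trans
    (Lp.fourierTransformₗᵢ (Pos n) (Col m)).symm)

end Group

/-! ### Warped convolutions of unbounded operators -/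

section Warped

variable {n : ℕ} {K : Type*} [NormedAddCommGroup K] [InnerProductSpace ℂ K]

/-- The adjoint action `A ↦ W A W⁻¹` of a unitary operator on unbounded operators. -/
def adjointAction (W : K ≃ₗᵢ[ℂ] K) (A : K →ₗ.[ℂ] K) : K →ₗ.[ℂ] K where
  domain := A.domain.comap (W.symm.toLinearEquiv : K →ₗ[ℂ] K)
  toFun := (W.toLinearEquiv : K →ₗ[ℂ] K) ∘ₗ A.toFun ∘ₗ
    ((W.symm.toLinearEquiv : K →ₗ[ℂ] K).restrict fun _ h => h)

/-- The integrand `χ(εx, εy) e^{-i x·y} U(y) α^τ_{Θx}(A) Φ` of the warped convolution of `A`,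
where `α^τ_k(A) = U^τ(k) A U^τ(k)⁻¹`. Here `x = (x_k)` is the spectral variable dual to
`y = (y^k)`, with `x·y = ∑_k x_k y^k` and `(Θx)^i = ∑_k Θ^{ik} x_k`. -/
def warpedIntegrand (U Uτ : Pos n → K ≃ₗᵢ[ℂ] K) (Θ : Matrix (Fin n) (Fin n) ℝ) (A : K →ₗ.[ℂ] K)
    (Φ : K) (hΦ : ∀ x, Φ ∈ (adjointAction (Uτ (Matrix.toEuclideanLin Θ x)) A).domain)
    (χ : 𝓢(Pos n × Pos n, ℂ)) (ε : ℝ) (z : Pos n × Pos n) : K :=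
  (χ (ε • z) * Complex.exp (-Complex.I * ((∑ k, z.1 k * z.2 k : ℝ) : ℂ))) •
    U z.2 (adjointAction (Uτ (Matrix.toEuclideanLin Θ z.1)) A ⟨Φ, hΦ z.1⟩)

/-- `η` is the value at `Φ` of the warped convolution `∫ dE(x) α^τ_{Θx}(A)`, that is, the strong
limit
`(2π)⁻ⁿ lim_{ε → 0} ∬ dx dy χ(εx, εy) e^{-i x·y} U(y) α^τ_{Θx}(A) Φ`
exists and equals `η` for every Schwartz cut-off `χ` with `χ(0,0) = 1`. -/
def IsWarpedValue (U Uτ : Pos n → K ≃ₗᵢ[ℂ] K) (Θ : Matrix (Fin n) (Fin n) ℝ) (A : K →ₗ.[ℂ] K)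
    (Φ η : K) : Prop :=
  ∃ hΦ : ∀ x, Φ ∈ (adjointAction (Uτ (Matrix.toEuclideanLin Θ x)) A).domain,
    ∀ χ : 𝓢(Pos n × Pos n, ℂ), χ 0 = 1 →
      (∀ ε : ℝ, 0 < ε → Integrable (warpedIntegrand U Uτ Θ A Φ hΦ χ ε)) ∧
      Tendsto (fun ε : ℝ => (((2 * Real.pi) ^ n)⁻¹ : ℝ) •
          ∫ z, warpedIntegrand U Uτ Θ A Φ hΦ χ ε z) (𝓝[>] 0) (𝓝 η)

theorem exists_cutoff (n : ℕ) : ∃ χ : 𝓢(Pos n × Pos n, ℂ), χ 0 = 1 := by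
  obtain ⟨f⟩ : Nonempty (ContDiffBump (0 : Pos n × Pos n)) := inferInstance
  have h1 : HasCompactSupport (fun z => ((f z : ℝ) : ℂ)) :=
    f.hasCompactSupport.comp_left (g := fun t : ℝ => (t : ℂ)) (by simp)
  have h2 : ContDiff ℝ (⊤ : ℕ∞) (fun z => ((f z : ℝ) : ℂ)) :=
    Complex.ofRealCLM.contDiff.comp f.contDiff
  refine ⟨h1.toSchwartzMap h2, ?_⟩
  have h3 : f 0 = 1 := f.one_of_mem_closedBall (by simp [f.rIn_pos.le])
  change ((f 0 : ℝ) : ℂ) = 1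
  rw [h3]; simp

theorem IsWarpedValue.unique {U Uτ : Pos n → K ≃ₗᵢ[ℂ] K} {Θ : Matrix (Fin n) (Fin n) ℝ}
    {A : K →ₗ.[ℂ] K} {Φ η η' : K} (h : IsWarpedValue U Uτ Θ A Φ η)
    (h' : IsWarpedValue U Uτ Θ A Φ η') : η = η' := by
  obtain ⟨χ, hχ⟩ := exists_cutoff n
  obtain ⟨_, h⟩ := h
  obtain ⟨_, h'⟩ := h'
  exact tendsto_nhds_unique (h χ hχ).2 (h' χ hχ).2

theorem IsWarpedValue.add {U Uτ : Pos n → K ≃ₗᵢ[ℂ] K} {Θ : Matrix (Fin n) (Fin n) ℝ}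
    {A : K →ₗ.[ℂ] K} {Φ Φ' η η' : K} (h : IsWarpedValue U Uτ Θ A Φ η)
    (h' : IsWarpedValue U Uτ Θ A Φ' η') : IsWarpedValue U Uτ Θ A (Φ + Φ') (η + η') := by
  obtain ⟨d, h⟩ := h
  obtain ⟨d', h'⟩ := h'
  refine ⟨fun x => add_mem (d x) (d' x), fun χ hχ => ?_⟩
  have key : ∀ ε, warpedIntegrand U Uτ Θ A (Φ + Φ') (fun x => add_mem (d x) (d' x)) χ ε =
      warpedIntegrand U Uτ Θ A Φ d χ ε + warpedIntegrand U Uτ Θ A Φ' d' χ ε := by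
    intro ε
    funext z
    simp only [warpedIntegrand, Pi.add_apply]
    rw [← smul_add, ← map_add, ← LinearPMap.map_add]
    rfl
  refine ⟨fun ε hε => ?_, ?_⟩
  · rw [key]
    exact ((h χ hχ).1 ε hε).add ((h' χ hχ).1 ε hε)
  · refine ((h χ hχ).2.add (h' χ hχ).2).congr' ?_
    filter_upwards [self_mem_nhdsWithin] with ε hε
    rw [key, ← smul_add]
    congr 1
    exact (integral_add ((h χ hχ).1 ε hε) ((h' χ hχ).1 ε hε)).symm

theorem IsWarpedValue.smul {U Uτ : Pos n → K ≃ₗᵢ[ℂ] K} {Θ : Matrix (Fin n) (Fin n) ℝ}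
    {A : K →ₗ.[ℂ] K} {Φ η : K} (c : ℂ) (h : IsWarpedValue U Uτ Θ A Φ η) :
    IsWarpedValue U Uτ Θ A (c • Φ) (c • η) := by
  obtain ⟨d, h⟩ := h
  refine ⟨fun x => Submodule.smul_mem _ c (d x), fun χ hχ => ?_⟩
  have key : ∀ ε, warpedIntegrand U Uτ Θ A (c • Φ) (fun x => Submodule.smul_mem _ c (d x)) χ ε =
      c • warpedIntegrand U Uτ Θ A Φ d χ ε := by
    intro ε
    funext z
    simp only [warpedIntegrand, Pi.smul_apply]
    rw [smul_comm c]
    congr 1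
    rw [← map_smul, ← LinearPMap.map_smul]
    rfl
  refine ⟨fun ε hε => ?_, ?_⟩
  · rw [key]
    exact ((h χ hχ).1 ε hε).smul c
  · refine ((h χ hχ).2.const_smul c).congr fun ε => ?_
    rw [key, smul_comm c]
    congr 1
    exact (integral_smul c _).symm

theorem IsWarpedValue.zero (U Uτ : Pos n → K ≃ₗᵢ[ℂ] K) (Θ : Matrix (Fin n) (Fin n) ℝ)
    (A : K →ₗ.[ℂ] K) : IsWarpedValue U Uτ Θ A 0 0 := by
  refine ⟨fun x => zero_mem _, fun χ _ => ?_⟩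
  have key : ∀ ε, warpedIntegrand U Uτ Θ A 0 (fun x => zero_mem _) χ ε = 0 := by
    intro ε
    funext z
    simp only [warpedIntegrand, Pi.zero_apply]
    have : adjointAction (Uτ (Matrix.toEuclideanLin Θ z.1)) A ⟨0, zero_mem _⟩ = 0 :=
      LinearPMap.map_zero _
    rw [this, map_zero, smul_zero]
  simp only [key]
  refine ⟨fun ε _ => integrable_zero _ _ _, ?_⟩
  simp

/-- The non-abelian warped convolution `A^{Θ_τ} = ∫ dE(x) α^τ_{Θx}(A)` of an unbounded operator
`A`, where `E` is the spectral resolution of `U`, defined on all vectors on which the oscillatory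
integral is well defined. -/
def warpedConvolution (U Uτ : Pos n → K ≃ₗᵢ[ℂ] K) (Θ : Matrix (Fin n) (Fin n) ℝ)
    (A : K →ₗ.[ℂ] K) : K →ₗ.[ℂ] K where
  domain :=
    { carrier := {Φ | ∃ η, IsWarpedValue U Uτ Θ A Φ η}
      add_mem' := fun ⟨_, h⟩ ⟨_, h'⟩ => ⟨_, h.add h'⟩
      zero_mem' := ⟨0, IsWarpedValue.zero U Uτ Θ A⟩
      smul_mem' := fun c _ ⟨_, h⟩ => ⟨_, h.smul c⟩ }
  toFun :=
    { toFun := fun Φ => Φ.2.choose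
      map_add' := fun Φ Φ' =>
        (Φ + Φ').2.choose_spec.unique (Φ.2.choose_spec.add Φ'.2.choose_spec)
      map_smul' := fun c Φ => (c • Φ).2.choose_spec.unique (Φ.2.choose_spec.smul c) }

theorem warpedConvolution_apply {U Uτ : Pos n → K ≃ₗᵢ[ℂ] K} {Θ : Matrix (Fin n) (Fin n) ℝ}
    {A : K →ₗ.[ℂ] K} {Φ η : K} (h : IsWarpedValue U Uτ Θ A Φ η) :
    warpedConvolution U Uτ Θ A ⟨Φ, ⟨η, h⟩⟩ = η :=
  (Exists.choose_spec (⟨η, h⟩ : ∃ η, IsWarpedValue U Uτ Θ A Φ η)).unique h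

end Warped

/-- The deformed coordinate operator `X^{i,Θ_τ}` with generator of deformations
`Q_k = P_k ⊗ M`: the non-abelian warped convolution of `X^i ⊗ 1` with
`U(p) = exp(i p^k P_k ⊗ 1)` and `U^τ(p) = exp(i p^k P_k ⊗ M)`. -/
def deformedCoordinate {n m : ℕ} (Θ : Matrix (Fin n) (Fin n) ℝ) (M : Matrix (Fin m) (Fin m) ℂ)
    (hM : M.IsHermitian) (i : Fin n) : Hilb n m →ₗ.[ℂ] Hilb n m :=
  warpedConvolution (momentumGroup 1) (momentumGroup (hermitianOp M hM)) Θ (coordinate i)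

end MoyalWeyl

end

open MoyalWeyl

open MeasureTheory Filter Topology
open scoped SchwartzMap FourierTransform LineDeriv

noncomputable section

/-! Conjugation by `exp(i p·P ⊗ M)` becomes transparent on the Fourier side. There `X^i` is `(i/2π)
∂_i` and the group multiplies by `exp(-2πi ⟨p, ξ⟩ M)`, so conjugation adds a constant matrix: `X^i`
becomes `X^i - p^i M` on Schwartz vectors (`adjointAction_coordinate_incl`). At `p = Θx` the shift
is `⟨x, r⟩ M`, where `r` is row `i` of `Θ`. The warped integrand is therefore `χ(εx, εy) e^{-i⟨x,
y⟩} (F(y) - ⟨x, r⟩ G(y))` with `F(y) = U(y) X^i Φ` and `G(y) = U(y) M Φ`, both bounded and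
continuous in `y`.

Two oscillatory limits finish part 1. Without a weight, the regularised integral of `F` tends to
`F(0)`, a form of Fourier inversion for the cut-off (`tendsto_integral_osc`). The weight `⟨x, r⟩` is
turned into `-i ∂_r` by integration by parts in `y` (`tendsto_integral_inner_smul_osc`). Since
`U(y)` is translation with generator `-∂_r` along `r` (`hasLineDerivAt_momentumGroup_one`), the
value is `X^i Φ - i ∂_r M Φ`, which is `(X^i - (ΘP)^i ⊗ M) Φ`.

For part 2, this value is again a Schwartz vector, so products are defined and the commutator is the
algebraic computation `deformedS_commutator`: only `[∂_r, x^j] = r^j` contributes, once from each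
factor, and skew-symmetry makes the two contributions equal. -/

namespace MoyalWeyl

/-! ### Regularised oscillatory integrals with Schwartz cut-offs. -/

section Oscillatory

variable {n : ℕ}

/-- The slice `x ↦ χ (x, v)` of a Schwartz function on a product. -/
def slice (χ : 𝓢(Pos n × Pos n, ℂ)) (v : Pos n) : 𝓢(Pos n, ℂ) :=
  SchwartzMap.compCLMOfAntilipschitz ℂ (g := fun x : Pos n => (x, v)) (K := 1)
    (by
      have h : (fun x : Pos n => (x, v)) =
          fun x => ContinuousLinearMap.inl ℝ (Pos n) (Pos n) x + (0, v) := by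
        funext x; simp
      rw [h]
      exact (ContinuousLinearMap.hasTemperateGrowth _).add (.const _))
    (fun x y => by simp [Prod.edist_eq]) χ

theorem slice_apply (χ : 𝓢(Pos n × Pos n, ℂ)) (v x : Pos n) : slice χ v x = χ (x, v) := rfl

/-- The slice is `χ` composed with an affine embedding whose linear part has norm at most one, and
`‖x‖ ≤ ‖(x, v)‖` in the max norm. What matters is that the bound does not depend on `v`. -/
theorem seminorm_slice_le (χ : 𝓢(Pos n × Pos n, ℂ)) (v : Pos n) (k l : ℕ) :
    SchwartzMap.seminorm ℂ k l (slice χ v) ≤ SchwartzMap.seminorm ℂ k l χ := by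
  refine SchwartzMap.seminorm_le_bound ℂ k l _ (apply_nonneg _ _) fun x => ?_
  refine le_trans ?_ (SchwartzMap.le_seminorm ℂ k l χ (x, v))
  have h1 : (slice χ v : Pos n → ℂ) =
      (fun z => χ (z + (0, v))) ∘ ContinuousLinearMap.inl ℝ (Pos n) (Pos n) := by
    funext x; simp [slice_apply]
  have h2 : ContDiff ℝ (⊤ : ℕ∞) fun z => χ (z + (0, v)) :=
    (χ.smooth ⊤).comp (contDiff_id.add contDiff_const)
  rw [h1, ContinuousLinearMap.iteratedFDeriv_comp_right _ h2 x (mod_cast le_top),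
    iteratedFDeriv_comp_add_right]
  have h3 : (ContinuousLinearMap.inl ℝ (Pos n) (Pos n)) x + (0, v) = (x, v) := by simp
  rw [h3]
  gcongr
  · exact le_max_left _ _
  · refine (ContinuousMultilinearMap.norm_compContinuousLinearMap_le _ _).trans ?_
    refine mul_le_of_le_one_right (norm_nonneg _) (Finset.prod_le_one (fun _ _ => norm_nonneg _) ?_)
    intro _ _
    exact ContinuousLinearMap.opNorm_le_bound _ zero_le_one fun y => by simp [Prod.norm_def]

/-- The Fourier transforms of the slices of a Schwartz function decay uniformly. -/
theorem exists_fourier_slice_decay (χ : 𝓢(Pos n × Pos n, ℂ)) (k : ℕ) :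
    ∃ C, ∀ v w : Pos n, ‖w‖ ^ k * ‖𝓕 (slice χ v) w‖ ≤ C := by
  let p : Seminorm ℂ 𝓢(Pos n, ℂ) := (SchwartzMap.seminorm ℂ k 0).comp
    (SchwartzMap.fourierTransformCLM ℂ (V := Pos n) (E := ℂ)).toLinearMap
  have hp : Continuous p :=
    ((schwartz_withSeminorms ℂ (Pos n) ℂ).continuous_seminorm (k, 0)).comp
      (SchwartzMap.fourierTransformCLM ℂ (V := Pos n) (E := ℂ)).continuous
  -- Continuity of the Fourier transform bounds this seminorm by finitely many Schwartz seminorms of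
  -- the slice, hence of `χ`, uniformly in `v`.
  obtain ⟨s, C, -, h⟩ := Seminorm.bound_of_continuous (schwartz_withSeminorms ℂ (Pos n) ℂ) p hp
  refine ⟨C * (s.sup (schwartzSeminormFamily ℂ (Pos n × Pos n) ℂ)) χ, fun v w => ?_⟩
  refine (SchwartzMap.norm_pow_mul_le_seminorm ℂ (𝓕 (slice χ v)) k w).trans ((h (slice χ v)).trans ?_)
  change (C : ℝ) * _ ≤ _
  gcongr
  refine Seminorm.finset_sup_apply_le (apply_nonneg _ _) fun i hi => ?_
  refine (seminorm_slice_le χ v i.1 i.2).trans ?_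
  exact Seminorm.le_finset_sup_apply (p := schwartzSeminormFamily ℂ (Pos n × Pos n) ℂ) hi

/-- Supplies the dominating function for the limit `ε → 0`, in which the slice parameter `v` moves
together with `w`. The exponent `l` is chosen so that `(1 + ‖w‖)^(-l)` is integrable. -/
theorem exists_fourier_slice_bound (χ : 𝓢(Pos n × Pos n, ℂ)) :
    ∃ b : Pos n → ℝ, Integrable b ∧ ∀ v w : Pos n, ‖𝓕 (slice χ v) w‖ ≤ b w := by
  set l := (volume : Measure (Pos n)).integrablePower
  obtain ⟨C₁, h₁⟩ := exists_fourier_slice_decay χ 0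
  obtain ⟨C₂, h₂⟩ := exists_fourier_slice_decay χ l
  refine ⟨fun w => 2 ^ l * (C₁ + C₂) * (1 + ‖w‖) ^ (-(l : ℝ)),
    (Measure.integrable_pow_neg_integrablePower _).const_mul _, fun v w => ?_⟩
  have := pow_mul_le_of_le_of_pow_mul_le (k := 0) (l := l) (norm_nonneg w)
    (norm_nonneg (𝓕 (slice χ v) w)) (by simpa using h₁ v w) (by simpa using h₂ v w)
  simpa using this

theorem exists_slice_bound (χ : 𝓢(Pos n × Pos n, ℂ)) :
    ∃ b : Pos n → ℝ, Integrable b ∧ ∀ v x : Pos n, ‖χ (x, v)‖ ≤ b x := by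
  set l := (volume : Measure (Pos n)).integrablePower
  have h (k : ℕ) (v x : Pos n) : ‖x‖ ^ k * ‖χ (x, v)‖ ≤ SchwartzMap.seminorm ℂ k 0 χ :=
    le_trans (by gcongr; exact le_max_left _ _)
      (SchwartzMap.norm_pow_mul_le_seminorm ℂ χ k (x, v))
  refine ⟨fun w => 2 ^ l * (SchwartzMap.seminorm ℂ 0 0 χ + SchwartzMap.seminorm ℂ l 0 χ) *
    (1 + ‖w‖) ^ (-(l : ℝ)), (Measure.integrable_pow_neg_integrablePower _).const_mul _, fun v x => ?_⟩
  have := pow_mul_le_of_le_of_pow_mul_le (k := 0) (l := l) (norm_nonneg x)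
    (norm_nonneg (χ (x, v))) (by simpa using h 0 v x) (by simpa using h l v x)
  simpa using this

theorem fourier_slice_eq (χ : 𝓢(Pos n × Pos n, ℂ)) (v w : Pos n) :
    𝓕 (slice χ v) w =
      ∫ x : Pos n, Complex.exp ((-2 * Real.pi * inner ℝ x w : ℝ) * Complex.I) * χ (x, v) := by
  rw [SchwartzMap.fourier_coe, Real.fourier_eq']
  rfl

/-- Joint continuity is needed because both arguments are evaluated along `v = 2πε² w`: it gives
measurability in `w` and the pointwise limit in `ε`. -/
theorem continuous_fourier_slice (χ : 𝓢(Pos n × Pos n, ℂ)) :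
    Continuous fun z : Pos n × Pos n => 𝓕 (slice χ z.1) z.2 := by
  simp only [fourier_slice_eq]
  obtain ⟨b, hb, h⟩ := exists_slice_bound χ
  refine continuous_of_dominated (bound := b) (fun z => ?_) (fun z => ?_) hb ?_
  · exact Continuous.aestronglyMeasurable (by fun_prop)
  · refine Eventually.of_forall fun x => ?_
    rw [norm_mul, Complex.norm_exp_ofReal_mul_I, one_mul]
    exact h _ _
  · exact Eventually.of_forall fun x => by fun_prop

/-- Fourier inversion evaluated at the origin. -/
theorem integral_fourier_slice (χ : 𝓢(Pos n × Pos n, ℂ)) (v : Pos n) :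
    ∫ w, 𝓕 (slice χ v) w = χ (0, v) := by
  have h : 𝓕⁻ (𝓕 (slice χ v)) 0 = slice χ v 0 := by
    rw [FourierTransform.fourierInv_fourier_eq]
  rw [SchwartzMap.fourierInv_coe, Real.fourierInv_eq'] at h
  simpa [slice_apply] using h

variable {K : Type*} [NormedAddCommGroup K] [NormedSpace ℂ K]

/-- The integrand `χ(εx, εy) e^{-i⟨x, y⟩} F(y)` of an oscillatory integral. -/
def osc (χ : 𝓢(Pos n × Pos n, ℂ)) (ε : ℝ) (F : Pos n → K) (z : Pos n × Pos n) : K :=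
  (χ (ε • z) * Complex.exp (-Complex.I * ((inner ℝ z.1 z.2 : ℝ) : ℂ))) • F z.2

theorem norm_exp_neg_I_mul (t : ℝ) : ‖Complex.exp (-Complex.I * (t : ℂ))‖ = 1 := by
  rw [show -Complex.I * (t : ℂ) = ((-t : ℝ) : ℂ) * Complex.I by push_cast; ring,
    Complex.norm_exp_ofReal_mul_I]

instance isAddHaarMeasure_volume_prod :
    (volume : Measure (Pos n × Pos n)).IsAddHaarMeasure :=
  inferInstanceAs ((volume : Measure (Pos n)).prod (volume : Measure (Pos n))).IsAddHaarMeasure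

theorem integrable_osc (χ : 𝓢(Pos n × Pos n, ℂ)) {ε : ℝ} (hε : 0 < ε) {F : Pos n → K}
    (hF : Continuous F) {C : ℝ} (hC : ∀ y, ‖F y‖ ≤ C) : Integrable (osc χ ε F) := by
  have h1 : Integrable fun z : Pos n × Pos n => ‖χ (ε • z)‖ * C :=
    ((integrable_comp_smul_iff volume χ hε.ne').2 χ.integrable).norm.mul_const C
  refine h1.mono' ?_ (Eventually.of_forall fun z => ?_)
  · unfold osc
    exact Continuous.aestronglyMeasurable (by fun_prop)
  · rw [osc, norm_smul, norm_mul, norm_exp_neg_I_mul, mul_one]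
    gcongr
    exact hC _

/-- Integrating over `x` first produces `ε⁻ⁿ` times the Fourier transform of a slice at frequency
`y/(2πε)`. The substitution `y = 2πε w` then turns the singular kernel into one that is integrable
uniformly in `ε`, with only the arguments of `F` and of the slice shrinking. -/
theorem integral_osc [CompleteSpace K] (χ : 𝓢(Pos n × Pos n, ℂ)) {ε : ℝ} (hε : 0 < ε)
    {F : Pos n → K} (hF : Continuous F) {C : ℝ} (hC : ∀ y, ‖F y‖ ≤ C) :
    ∫ z, osc χ ε F z = ((2 * Real.pi) ^ n : ℝ) •
      ∫ w, 𝓕 (slice χ ((2 * Real.pi * ε ^ 2) • w)) w • F ((2 * Real.pi * ε) • w) := by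
  have hc : 0 < 2 * Real.pi * ε := by positivity
  have inner_int (y : Pos n) : ∫ x, osc χ ε F (x, y) =
      ((ε ^ n)⁻¹ : ℝ) • (𝓕 (slice χ (ε • y)) ((2 * Real.pi * ε)⁻¹ • y) • F y) := by
    have h1 := Measure.integral_comp_smul (volume : Measure (Pos n)) (fun x : Pos n =>
      Complex.exp ((-2 * Real.pi * inner ℝ x ((2 * Real.pi * ε)⁻¹ • y) : ℝ) * Complex.I) *
        χ (x, ε • y)) ε
    rw [← fourier_slice_eq, finrank_euclideanSpace_fin, abs_of_pos (by positivity)] at h1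
    rw [← smul_assoc, ← h1, ← integral_smul_const]
    congr 1
    funext x
    simp only [osc]
    congr 1
    rw [mul_comm]
    congr 2
    rw [inner_smul_left, inner_smul_right]
    simp only [conj_trivial]
    have : -2 * Real.pi * (ε * ((2 * Real.pi * ε)⁻¹ * inner ℝ x y)) = - inner ℝ x y := by
      field_simp
    rw [this]
    push_cast; ring
  have h2 := Measure.integral_comp_smul (volume : Measure (Pos n)) (fun y : Pos n =>
    𝓕 (slice χ (ε • y)) ((2 * Real.pi * ε)⁻¹ • y) • F y) (2 * Real.pi * ε)
  have h3 : ∫ z, osc χ ε F z = ∫ y, ∫ x, osc χ ε F (x, y) :=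
    integral_prod_symm _ (integrable_osc χ hε hF hC)
  rw [h3]
  simp only [inner_int]
  rw [integral_smul]
  rw [finrank_euclideanSpace_fin, abs_of_pos (by positivity)] at h2
  -- The slice parameter is `εy = ε · 2πε w`, whence the square of `ε`.
  have h4 : ∀ w : Pos n, ε • (2 * Real.pi * ε) • w = (2 * Real.pi * ε ^ 2) • w := fun w => by
    rw [smul_smul]; congr 1; ring
  simp only [h4, inv_smul_smul₀ hc.ne'] at h2
  rw [h2, smul_smul]
  -- The Jacobian `(2πε)ⁿ` and the factor `ε⁻ⁿ` leave `(2π)ⁿ`.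
  congr 1
  rw [mul_pow (2 * Real.pi) ε]
  field_simp

/-- A regularised oscillatory integral `(2π)⁻ⁿ ∬ e^{-i⟨x, y⟩} F(y)` converges to `F 0`. -/
theorem tendsto_integral_osc [CompleteSpace K] (χ : 𝓢(Pos n × Pos n, ℂ))
    {F : Pos n → K} (hF : Continuous F) {C : ℝ} (hC : ∀ y, ‖F y‖ ≤ C) :
    Tendsto (fun ε : ℝ => (((2 * Real.pi) ^ n)⁻¹ : ℝ) • ∫ z, osc χ ε F z) (𝓝[>] 0)
      (𝓝 (χ 0 • F 0)) := by
  have key : Tendsto (fun ε : ℝ =>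
      ∫ w, 𝓕 (slice χ ((2 * Real.pi * ε ^ 2) • w)) w • F ((2 * Real.pi * ε) • w)) (𝓝[>] 0)
      (𝓝 (∫ w, 𝓕 (slice χ 0) w • F 0)) := by
    obtain ⟨b, hb, h⟩ := exists_fourier_slice_bound χ
    have hc := continuous_fourier_slice χ
    refine tendsto_integral_filter_of_dominated_convergence (fun w => b w * C)
      (Eventually.of_forall fun ε => ?_) (Eventually.of_forall fun ε => ?_) (hb.mul_const C) ?_
    · refine Continuous.aestronglyMeasurable (Continuous.smul ?_ (by fun_prop))
      exact hc.comp (f := fun w : Pos n => ((2 * Real.pi * ε ^ 2) • w, w)) (by fun_prop)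
    · refine Eventually.of_forall fun w => ?_
      rw [norm_smul]
      exact mul_le_mul (h _ _) (hC _) (norm_nonneg _) ((norm_nonneg _).trans (h 0 w))
    · refine Eventually.of_forall fun w => tendsto_nhdsWithin_of_tendsto_nhds ?_
      have h1 : Continuous fun ε : ℝ =>
          𝓕 (slice χ ((2 * Real.pi * ε ^ 2) • w)) w • F ((2 * Real.pi * ε) • w) :=
        Continuous.smul (hc.comp (f := fun ε : ℝ => ((2 * Real.pi * ε ^ 2) • w, w)) (by fun_prop))
          (by fun_prop)
      simpa using h1.tendsto 0
  rw [integral_smul_const, integral_fourier_slice] at key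
  refine key.congr' ?_
  filter_upwards [self_mem_nhdsWithin] with ε hε
  rw [integral_osc χ hε hF hC, smul_smul, inv_mul_cancel₀ (by positivity), one_smul]

/-- Multiplication of a Schwartz function on a product by `⟨x, e⟩`. -/
def innerFstMul (e : Pos n) (χ : 𝓢(Pos n × Pos n, ℂ)) : 𝓢(Pos n × Pos n, ℂ) :=
  SchwartzMap.smulLeftCLM ℂ (fun z : Pos n × Pos n => inner ℝ z.1 e) χ

theorem innerFstMul_apply (e : Pos n) (χ : 𝓢(Pos n × Pos n, ℂ)) (z : Pos n × Pos n) :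
    innerFstMul e χ z = inner ℝ z.1 e • χ z :=
  SchwartzMap.smulLeftCLM_apply_apply
    (((innerSL ℝ).flip e ∘L ContinuousLinearMap.fst ℝ (Pos n) (Pos n)).hasTemperateGrowth) χ z

/-- At fixed `ε` the polynomial weight is absorbed into the cut-off, so the weighted integrand is
again of the form `osc`. This gives integrability; the factor `ε⁻¹` makes it useless for the limit.
-/
theorem inner_smul_osc (χ : 𝓢(Pos n × Pos n, ℂ)) {ε : ℝ} (hε : 0 < ε) (F : Pos n → K)
    (e : Pos n) (z : Pos n × Pos n) :
    ((inner ℝ z.1 e : ℝ) : ℂ) • osc χ ε F z = (ε⁻¹ : ℂ) • osc (innerFstMul e χ) ε F z := by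
  simp only [osc, innerFstMul_apply, smul_smul, Prod.smul_fst, inner_smul_left, conj_trivial,
    Complex.real_smul]
  congr 1
  have : (ε : ℂ) ≠ 0 := by exact_mod_cast hε.ne'
  push_cast
  field_simp

theorem integrable_inner_smul_osc (χ : 𝓢(Pos n × Pos n, ℂ)) {ε : ℝ} (hε : 0 < ε)
    {F : Pos n → K} (hF : Continuous F) {C : ℝ} (hC : ∀ y, ‖F y‖ ≤ C) (e : Pos n) :
    Integrable fun z : Pos n × Pos n => ((inner ℝ z.1 e : ℝ) : ℂ) • osc χ ε F z := by
  simp only [inner_smul_osc χ hε]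
  exact (integrable_osc _ hε hF hC).smul _

/-- Integration by parts in the direction `(0, e)`: differentiating the phase yields `-i⟨x, e⟩`, and
differentiating the cut-off yields an error carrying a factor `ε`. -/
theorem integral_inner_smul_osc [CompleteSpace K] (χ : 𝓢(Pos n × Pos n, ℂ)) {ε : ℝ} (hε : 0 < ε)
    {F F' : Pos n → K} (hF : Continuous F) {C : ℝ} (hC : ∀ y, ‖F y‖ ≤ C)
    (hF' : Continuous F') {C' : ℝ} (hC' : ∀ y, ‖F' y‖ ≤ C') (e : Pos n)
    (hd : ∀ y, HasLineDerivAt ℝ F (F' y) y e) :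
    ∫ z : Pos n × Pos n, ((inner ℝ z.1 e : ℝ) : ℂ) • osc χ ε F z =
      -Complex.I • (∫ z, osc χ ε F' z) -
        (Complex.I * ε) • ∫ z, osc (∂_{((0, e) : Pos n × Pos n)} χ) ε F z := by
  set f : Pos n × Pos n → ℂ := fun z =>
    χ (ε • z) * Complex.exp (-Complex.I * ((inner ℝ z.1 z.2 : ℝ) : ℂ)) with hf
  set f' : Pos n × Pos n → ℂ := fun z =>
    (ε * (∂_{((0, e) : Pos n × Pos n)} χ) (ε • z) +
      χ (ε • z) * (-Complex.I * ((inner ℝ z.1 e : ℝ) : ℂ))) *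
      Complex.exp (-Complex.I * ((inner ℝ z.1 z.2 : ℝ) : ℂ)) with hf'
  have hfd : ∀ z, HasLineDerivAt ℝ f (f' z) z (0, e) := by
    intro z
    rw [HasLineDerivAt]
    have h1 : HasDerivAt (fun t : ℝ => ε • (z + t • ((0, e) : Pos n × Pos n)))
        (ε • ((0, e) : Pos n × Pos n)) 0 := by
      have h := (((hasDerivAt_id (0 : ℝ)).smul_const ((0, e) : Pos n × Pos n)).const_add
        z).const_smul ε
      rwa [one_smul] at h
    have h2 : HasDerivAt (fun t : ℝ => χ (ε • (z + t • ((0, e) : Pos n × Pos n))))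
        (ε * (∂_{((0, e) : Pos n × Pos n)} χ) (ε • z)) 0 := by
      have h := (χ.hasFDerivAt (ε • (z + (0 : ℝ) • ((0, e) : Pos n × Pos n)))).comp_hasDerivAt
        (0 : ℝ) h1
      rwa [map_smul, Complex.real_smul, zero_smul, add_zero,
        ← SchwartzMap.lineDerivOp_apply_eq_fderiv] at h
    have h3 : HasDerivAt (fun t : ℝ => -Complex.I * ((inner ℝ (z + t • ((0, e) : Pos n × Pos n)).1
        (z + t • ((0, e) : Pos n × Pos n)).2 : ℝ) : ℂ)) (-Complex.I * ((inner ℝ z.1 e : ℝ) : ℂ)) 0 := by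
      -- Only the second component moves, so the phase is affine in `t`.
      have h : HasDerivAt (fun t : ℝ => inner ℝ z.1 z.2 + t * inner ℝ z.1 e) (inner ℝ z.1 e) 0 := by
        simpa using ((hasDerivAt_id (0 : ℝ)).mul_const (inner ℝ z.1 e)).const_add (inner ℝ z.1 z.2)
      refine ((h.ofReal_comp).const_mul (-Complex.I)).congr_of_eventuallyEq
        (Eventually.of_forall fun t => ?_)
      simp [inner_add_right, inner_smul_right]
    refine (h2.mul h3.cexp).congr_deriv ?_
    simp only [zero_smul, add_zero, hf']
    ring
  have e1 : ∀ z, f' z • F z.2 = (ε : ℂ) • osc (∂_{((0, e) : Pos n × Pos n)} χ) ε F z +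
      -Complex.I • (((inner ℝ z.1 e : ℝ) : ℂ) • osc χ ε F z) := by
    intro z
    simp only [hf', osc, smul_smul, ← add_smul]
    congr 1
    ring
  have i1 := integrable_osc (∂_{((0, e) : Pos n × Pos n)} χ) hε hF hC
  have i2 := integrable_inner_smul_osc χ hε hF hC e
  have i3 := (i1.smul (ε : ℂ)).add (i2.smul (-Complex.I))
  have hp := integral_bilinear_hasLineDerivAt_right_eq_neg_left_of_integrable
    (μ := (volume : Measure (Pos n × Pos n))) (f := f) (f' := f') (g := fun z => F z.2)
    (g' := fun z => F' z.2) (v := ((0, e) : Pos n × Pos n))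
    (B := ContinuousLinearMap.lsmul ℝ ℂ (E := K))
    (i3.congr (Eventually.of_forall fun z => (e1 z).symm)) (integrable_osc χ hε hF' hC')
    (integrable_osc χ hε hF hC) (fun z _ => hfd z) (fun z _ => by
      have := hd z.2
      rw [HasLineDerivAt] at this ⊢
      simpa using this)
  simp only [ContinuousLinearMap.lsmul_apply, e1] at hp
  have hs := integral_add (i1.smul (ε : ℂ)) (i2.smul (-Complex.I))
  simp only [Pi.smul_apply, integral_smul] at hs
  rw [hs] at hp
  change ∫ z, osc χ ε F' z = _ at hp
  rw [hp]
  simp only [smul_neg, smul_add, smul_smul, neg_smul, neg_neg, neg_mul, Complex.I_mul_I,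
    one_smul]
  abel

/-- A regularised oscillatory integral `(2π)⁻ⁿ ∬ ⟨x, e⟩ e^{-i⟨x, y⟩} F(y)` converges to
`-i ∂_e F(0)`. -/
theorem tendsto_integral_inner_smul_osc [CompleteSpace K] (χ : 𝓢(Pos n × Pos n, ℂ))
    {F F' : Pos n → K} (hF : Continuous F) {C : ℝ} (hC : ∀ y, ‖F y‖ ≤ C)
    (hF' : Continuous F') {C' : ℝ} (hC' : ∀ y, ‖F' y‖ ≤ C') (e : Pos n)
    (hd : ∀ y, HasLineDerivAt ℝ F (F' y) y e) :
    Tendsto (fun ε : ℝ => (((2 * Real.pi) ^ n)⁻¹ : ℝ) •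
      ∫ z : Pos n × Pos n, ((inner ℝ z.1 e : ℝ) : ℂ) • osc χ ε F z) (𝓝[>] 0)
      (𝓝 (-Complex.I • χ 0 • F' 0)) := by
  have h1 := (tendsto_integral_osc χ hF' hC').const_smul (-Complex.I)
  have h2 := tendsto_integral_osc (∂_{((0, e) : Pos n × Pos n)} χ) hF hC
  have h3 : Tendsto (fun ε : ℝ => Complex.I * (ε : ℂ)) (𝓝[>] 0) (𝓝 0) := by
    have : Continuous fun ε : ℝ => Complex.I * (ε : ℂ) := by fun_prop
    exact tendsto_nhdsWithin_of_tendsto_nhds (by simpa using this.tendsto 0)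
  -- The cut-off derivative is itself Schwartz, so its oscillatory integral converges and the factor
  -- `ε` kills it.
  have h4 := h1.sub (h3.smul h2)
  rw [zero_smul, sub_zero] at h4
  refine h4.congr' ?_
  filter_upwards [self_mem_nhdsWithin] with ε hε
  rw [integral_inner_smul_osc χ hε hF hC hF' hC' e hd, smul_sub, smul_comm (-Complex.I),
    smul_comm (Complex.I * (ε : ℂ))]

theorem tendsto_integral_osc_sub_inner_smul_osc [CompleteSpace K] (χ : 𝓢(Pos n × Pos n, ℂ))
    (hχ : χ 0 = 1) {F G G' : Pos n → K} (hF : Continuous F) {CF : ℝ} (bF : ∀ y, ‖F y‖ ≤ CF)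
    (hG : Continuous G) {CG : ℝ} (bG : ∀ y, ‖G y‖ ≤ CG)
    (hG' : Continuous G') {CG' : ℝ} (bG' : ∀ y, ‖G' y‖ ≤ CG') (e : Pos n)
    (hd : ∀ y, HasLineDerivAt ℝ G (G' y) y e) {J : ℝ → Pos n × Pos n → K}
    (hJ : ∀ ε z, J ε z = osc χ ε F z - ((inner ℝ z.1 e : ℝ) : ℂ) • osc χ ε G z) :
    (∀ ε, 0 < ε → Integrable (J ε)) ∧
      Tendsto (fun ε : ℝ => (((2 * Real.pi) ^ n)⁻¹ : ℝ) • ∫ z, J ε z) (𝓝[>] 0)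
        (𝓝 (F 0 + Complex.I • G' 0)) := by
  obtain rfl : J = fun ε z => osc χ ε F z - ((inner ℝ z.1 e : ℝ) : ℂ) • osc χ ε G z :=
    funext fun ε => funext (hJ ε)
  have iF (ε : ℝ) (hε : 0 < ε) := integrable_osc χ hε hF bF
  have iG (ε : ℝ) (hε : 0 < ε) := integrable_inner_smul_osc χ hε hG bG e
  refine ⟨fun ε hε => (iF ε hε).sub (iG ε hε), ?_⟩
  have h := (tendsto_integral_osc χ hF bF).sub
    (tendsto_integral_inner_smul_osc χ hG bG hG' bG' e hd)
  rw [hχ, one_smul, one_smul, neg_smul, sub_neg_eq_add] at h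
  refine h.congr' ?_
  filter_upwards [self_mem_nhdsWithin] with ε hε
  rw [integral_sub (iF ε hε) (iG ε hε), smul_sub]

end Oscillatory

/-! ### Bounded one-parameter groups have temperate growth. -/

section OneParameterGroup

variable {A : Type*} [NormedRing A] [NormedAlgebra ℝ A] [CompleteSpace A]

theorem iteratedDeriv_exp_smul (B : A) (k : ℕ) :
    iteratedDeriv k (fun t : ℝ => NormedSpace.exp (t • B)) =
      fun t : ℝ => NormedSpace.exp (t • B) * B ^ k := by
  induction k with
  | zero => simp
  | succ k ih =>
    funext t
    rw [iteratedDeriv_succ, ih, ((hasDerivAt_exp_smul_const B t).mul_const (B ^ k)).deriv,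
      mul_assoc, ← pow_succ']

/-- Each derivative is `exp(tB) B^k`, so boundedness of the group bounds all derivatives, with
growth exponent zero. -/
theorem hasTemperateGrowth_exp_smul (B : A) {C : ℝ}
    (hC : ∀ t : ℝ, ‖NormedSpace.exp (t • B)‖ ≤ C) :
    Function.HasTemperateGrowth fun t : ℝ => NormedSpace.exp (t • B) := by
  refine ⟨contDiff_of_differentiable_iteratedDeriv fun k _ => ?_, fun k => ⟨0, C * ‖B ^ k‖, fun t => ?_⟩⟩
  · rw [iteratedDeriv_exp_smul]
    exact fun t => ((hasDerivAt_exp_smul_const B t).mul_const (B ^ k)).differentiableAt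
  · rw [norm_iteratedFDeriv_eq_norm_iteratedDeriv, iteratedDeriv_exp_smul, pow_zero, mul_one]
    exact (norm_mul_le _ _).trans (by gcongr; exact hC t)

end OneParameterGroup

/-! ### The momentum group as a Fourier multiplier on Schwartz functions. -/

section Symbol

variable {n m : ℕ}

/-- The phase `-2π ∑ p^k ξ_k`, i.e. the value of `∑ p^k P_k` at the frequency `ξ`. -/
def phase (p : Pos n) : Pos n →L[ℝ] ℝ := -(2 * Real.pi) • innerSL ℝ p

theorem phase_apply (p ξ : Pos n) : phase p ξ = -(2 * Real.pi) * inner ℝ p ξ := rfl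

theorem phase_add (p q ξ : Pos n) : phase (p + q) ξ = phase p ξ + phase q ξ := by
  simp only [phase_apply, inner_add_left]; ring

theorem sum_mul_eq_inner (x y : Pos n) : ∑ k, x k * y k = inner ℝ x y := by
  rw [PiLp.inner_apply]
  exact Finset.sum_congr rfl fun k _ => by simp [mul_comm]

theorem coe_groupSymbol (M : selfAdjoint (Col m →L[ℂ] Col m)) (p ξ : Pos n) :
    (groupSymbol M p ξ : Col m →L[ℂ] Col m) =
      NormedSpace.exp (phase p ξ • (Complex.I • (M : Col m →L[ℂ] Col m))) := by
  rw [groupSymbol, selfAdjoint.expUnitary_coe]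
  change NormedSpace.exp (Complex.I • (((-(2 * Real.pi * ∑ k, p k * ξ k) : ℝ) : ℂ) •
    (M : Col m →L[ℂ] Col m))) = _
  rw [sum_mul_eq_inner, phase_apply, smul_comm, neg_mul]
  rfl

theorem groupSymbol_add (M : selfAdjoint (Col m →L[ℂ] Col m)) (p q ξ : Pos n) :
    (groupSymbol M (p + q) ξ : Col m →L[ℂ] Col m) = groupSymbol M p ξ * groupSymbol M q ξ := by
  have : NormedAlgebra ℚ (Col m →L[ℂ] Col m) := .restrictScalars ℚ ℝ _
  simp only [coe_groupSymbol, phase_add]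
  refine (congrArg _ (add_smul _ _ (Complex.I • (M : Col m →L[ℂ] Col m)))).trans (NormedSpace.exp_add_of_commute ?_)
  exact ((Commute.refl (Complex.I • (M : Col m →L[ℂ] Col m))).smul_left _).smul_right _

theorem groupSymbol_zero (M : selfAdjoint (Col m →L[ℂ] Col m)) (ξ : Pos n) :
    (groupSymbol M 0 ξ : Col m →L[ℂ] Col m) = 1 := by
  rw [coe_groupSymbol, phase_apply, inner_zero_left, mul_zero]
  exact (congrArg _ (zero_smul ℝ _)).trans NormedSpace.exp_zero

theorem norm_unitary_le_one (u : unitary (Col m →L[ℂ] Col m)) :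
    ‖(u : Col m →L[ℂ] Col m)‖ ≤ 1 :=
  ContinuousLinearMap.opNorm_le_bound _ zero_le_one fun v => by
    rw [norm_unitary_apply, one_mul]

/-- The symbol is a unitary one-parameter group composed with the linear form `phase p`. This is
what lets it act on Schwartz space. -/
theorem hasTemperateGrowth_groupSymbol (M : selfAdjoint (Col m →L[ℂ] Col m)) (p : Pos n) :
    Function.HasTemperateGrowth fun ξ => (groupSymbol M p ξ : Col m →L[ℂ] Col m) := by
  simp only [coe_groupSymbol]
  refine (hasTemperateGrowth_exp_smul (Complex.I • (M : Col m →L[ℂ] Col m)) (C := 1)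
    fun t => ?_).comp (phase p).hasTemperateGrowth
  -- The exponent is recognised as `i` times a self-adjoint operator, so its exponential is unitary
  -- and has norm at most one.
  have h : t • Complex.I • (M : Col m →L[ℂ] Col m) =
      Complex.I • ((⟨(t : ℂ) • (M : Col m →L[ℂ] Col m),
        IsSelfAdjoint.smul (Complex.conj_ofReal _) M.2⟩ : selfAdjoint (Col m →L[ℂ] Col m)) :
          Col m →L[ℂ] Col m) := by
    rw [smul_comm]
    rfl
  rw [h, ← selfAdjoint.expUnitary_coe]
  exact norm_unitary_le_one _

/-- Multiplication of Schwartz functions by the Fourier symbol of `exp(i p^k P_k ⊗ M)`. -/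
def symbolS (M : selfAdjoint (Col m →L[ℂ] Col m)) (p : Pos n) :
    𝓢(Pos n, Col m) →L[ℂ] 𝓢(Pos n, Col m) :=
  SchwartzMap.bilinLeftCLM (ContinuousLinearMap.apply ℂ (Col m))
    (hasTemperateGrowth_groupSymbol M p)

theorem symbolS_apply (M : selfAdjoint (Col m →L[ℂ] Col m)) (p : Pos n) (g : 𝓢(Pos n, Col m))
    (ξ : Pos n) : symbolS M p g ξ = (groupSymbol M p ξ : Col m →L[ℂ] Col m) (g ξ) := rfl

theorem symbolS_add (M : selfAdjoint (Col m →L[ℂ] Col m)) (p q : Pos n) (g : 𝓢(Pos n, Col m)) :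
    symbolS M (p + q) g = symbolS M p (symbolS M q g) := by
  ext1 ξ
  rw [symbolS_apply, groupSymbol_add]
  rfl

theorem symbolS_zero (M : selfAdjoint (Col m →L[ℂ] Col m)) (g : 𝓢(Pos n, Col m)) :
    symbolS M 0 g = g := by
  ext1 ξ
  rw [symbolS_apply, groupSymbol_zero]
  rfl

theorem coeFn_incl (Φ : 𝓢(Pos n, Col m)) : (incl Φ : Pos n → Col m) =ᵐ[volume] Φ :=
  Φ.coeFn_toLp 2 volume

theorem unitaryMul_groupSymbol_incl (M : selfAdjoint (Col m →L[ℂ] Col m)) (p : Pos n)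
    (g : 𝓢(Pos n, Col m)) :
    unitaryMul (groupSymbol M p) (continuous_groupSymbol M p) (incl g) = incl (symbolS M p g) := by
  apply Lp.ext
  filter_upwards [(memLp_unitary (continuous_groupSymbol M p) (incl g)).coeFn_toLp,
    coeFn_incl g, coeFn_incl (symbolS M p g)] with ξ h1 h2 h3
  refine Eq.trans h1 ?_
  rw [h2, h3, symbolS_apply]

theorem momentumGroup_incl (M : selfAdjoint (Col m →L[ℂ] Col m)) (p : Pos n)
    (Φ : 𝓢(Pos n, Col m)) :
    momentumGroup M p (incl Φ) = incl (𝓕⁻ (symbolS M p (𝓕 Φ))) := by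
  change 𝓕⁻ (unitaryMul (groupSymbol M p) (continuous_groupSymbol M p) (𝓕 (incl Φ))) = _
  have h : 𝓕 (incl Φ) = incl (𝓕 Φ) := SchwartzMap.toLp_fourier_eq Φ
  rw [h, unitaryMul_groupSymbol_incl]
  exact SchwartzMap.toLp_fourierInv_eq _

theorem momentumGroup_symm_incl (M : selfAdjoint (Col m →L[ℂ] Col m)) (p : Pos n)
    (Φ : 𝓢(Pos n, Col m)) :
    (momentumGroup M p).symm (incl Φ) = incl (𝓕⁻ (symbolS M (-p) (𝓕 Φ))) := by
  rw [LinearIsometryEquiv.symm_apply_eq, momentumGroup_incl, FourierTransform.fourier_fourierInv_eq,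
    ← symbolS_add, add_neg_cancel, symbolS_zero, FourierTransform.fourierInv_fourier_eq]

end Symbol

/-! ### Conjugating the coordinate operators by the momentum group. -/

section AdjointAction

variable {n m : ℕ}

theorem coordS_fourierInv (i : Fin n) (h : 𝓢(Pos n, Col m)) :
    coordS i (𝓕⁻ h) =
      (Complex.I / (2 * Real.pi)) • 𝓕⁻ (∂_{EuclideanSpace.single i (1 : ℝ)} h) := by
  have hp : (Real.pi : ℂ) ≠ 0 := by exact_mod_cast Real.pi_ne_zero
  have h1 : (fun x : Pos n => (inner ℝ x (EuclideanSpace.single i (1 : ℝ)) : ℝ)).HasTemperateGrowth :=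
    by fun_prop
  rw [SchwartzMap.fourierInv_lineDerivOp_eq]
  ext1 x
  rw [coordS_apply, smul_apply, smul_apply, SchwartzMap.smulLeftCLM_apply_apply h1,
    smul_smul, EuclideanSpace.inner_single_right]
  have h2 : Complex.I / (2 * Real.pi) * -(2 * Real.pi * Complex.I) = 1 := by
    field_simp
    rw [Complex.I_sq]; ring
  rw [h2, one_smul]
  simp

/-- The phase is linear in `ξ`, so differentiating the exponential contributes the constant matrix
`i · phase p e · M`. This commutator term is the source of the deformation. -/
theorem lineDerivOp_symbolS (M : selfAdjoint (Col m →L[ℂ] Col m)) (p e : Pos n)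
    (g : 𝓢(Pos n, Col m)) :
    ∂_{e} (symbolS M p g) =
      symbolS M p (∂_{e} g + (phase p e * Complex.I : ℂ) •
        g.postcompCLM (M : Col m →L[ℂ] Col m)) := by
  ext1 ξ
  have h1 : HasDerivAt (fun t : ℝ => phase p (ξ + t • e)) (phase p e) 0 := by
    simpa using ((hasDerivAt_id (0 : ℝ)).mul_const (phase p e)).const_add (phase p ξ)
  have h2 : HasDerivAt (fun t : ℝ => (groupSymbol M p (ξ + t • e) : Col m →L[ℂ] Col m))
      (phase p e • ((groupSymbol M p ξ : Col m →L[ℂ] Col m) *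
        (Complex.I • (M : Col m →L[ℂ] Col m)))) 0 := by
    simp only [coe_groupSymbol]
    have h := (hasDerivAt_exp_smul_const (Complex.I • (M : Col m →L[ℂ] Col m))
      (phase p (ξ + (0 : ℝ) • e))).scomp (0 : ℝ) h1
    simpa only [zero_smul, add_zero] using! h
  have h3 : HasDerivAt (fun t : ℝ => g (ξ + t • e)) ((∂_{e} g) ξ) 0 := by
    have h0 : HasDerivAt (fun t : ℝ => ξ + t • e) e 0 := by
      simpa using ((hasDerivAt_id (0 : ℝ)).smul_const e).const_add ξ
    have h := (g.hasFDerivAt (ξ + (0 : ℝ) • e)).comp_hasDerivAt (0 : ℝ) h0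
    rwa [zero_smul, add_zero, ← SchwartzMap.lineDerivOp_apply_eq_fderiv] at h
  have h4 := ((ContinuousLinearMap.apply ℂ (Col m) (E := Col m)).bilinearRestrictScalars
    ℝ).hasDerivAt_of_bilinear (fun _ => h3) (fun _ => h2)
  rw [SchwartzMap.lineDerivOp_apply, lineDeriv]
  refine h4.deriv.trans ?_
  simp only [ContinuousLinearMap.bilinearRestrictScalars_apply_apply,
    ContinuousLinearMap.apply_apply, zero_smul, add_zero, symbolS_apply, add_apply, smul_apply,
    map_add, map_smul, SchwartzMap.postcompCLM_apply, mul_smul]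
  rw [add_comm]
  congr 1
  simp

theorem fourier_postcomp (T : Col m →L[ℂ] Col m) (Φ : 𝓢(Pos n, Col m)) :
    𝓕 (Φ.postcompCLM T) = (𝓕 Φ).postcompCLM T := by
  ext1 ξ
  rw [SchwartzMap.postcompCLM_apply, SchwartzMap.fourier_coe, SchwartzMap.fourier_coe,
    Real.fourier_eq', Real.fourier_eq', ← ContinuousLinearMap.integral_comp_comm]
  · simp [SchwartzMap.postcompCLM_apply]
  · refine Φ.integrable.norm.mono' (Continuous.aestronglyMeasurable (by fun_prop))
      (Eventually.of_forall fun x => ?_)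
    rw [norm_smul, Complex.norm_exp_ofReal_mul_I, one_mul]

theorem incl_mem_coordinate_domain (i : Fin n) (Φ : 𝓢(Pos n, Col m)) :
    incl Φ ∈ (coordinate (m := m) i).domain :=
  (schwartzOp (coordS i)).le_closure.1 ⟨Φ, rfl⟩

/-- The closure extends the original operator, which is all that is needed of it on Schwartz
vectors. -/
theorem coordinate_incl (i : Fin n) (Φ : 𝓢(Pos n, Col m))
    (h : incl Φ ∈ (coordinate (m := m) i).domain) :
    coordinate i ⟨incl Φ, h⟩ = incl (coordS i Φ) := by
  have h1 := (schwartzOp (coordS (m := m) i)).le_closure.2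
    (x := ⟨incl Φ, ⟨Φ, rfl⟩⟩) (y := ⟨incl Φ, h⟩) rfl
  refine h1.symm.trans ?_
  change incl (coordS i ((LinearEquiv.ofInjective incl incl_injective).symm ⟨incl Φ, _⟩)) = _
  congr 2
  exact (LinearEquiv.symm_apply_eq _).2 rfl

theorem incl_mem_adjointAction_domain (M : selfAdjoint (Col m →L[ℂ] Col m)) (p : Pos n)
    (i : Fin n) (Φ : 𝓢(Pos n, Col m)) :
    incl Φ ∈ (adjointAction (momentumGroup M p) (coordinate i)).domain := by
  change (momentumGroup M p).symm (incl Φ) ∈ (coordinate i).domain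
  rw [momentumGroup_symm_incl]
  exact incl_mem_coordinate_domain i _

/-- `exp(i p^k P_k ⊗ M) X^i exp(-i p^k P_k ⊗ M) = X^i - p^i M` on Schwartz functions. -/
theorem adjointAction_coordinate_incl (M : selfAdjoint (Col m →L[ℂ] Col m)) (p : Pos n)
    (i : Fin n) (Φ : 𝓢(Pos n, Col m))
    (h : incl Φ ∈ (adjointAction (momentumGroup M p) (coordinate i)).domain) :
    adjointAction (momentumGroup M p) (coordinate i) ⟨incl Φ, h⟩ =
      incl (coordS i Φ) -
        ((p i : ℝ) : ℂ) • incl (Φ.postcompCLM (M : Col m →L[ℂ] Col m)) := by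
  have hp : (Real.pi : ℂ) ≠ 0 := by exact_mod_cast Real.pi_ne_zero
  have h1 : (⟨(momentumGroup M p).symm (incl Φ), h⟩ : (coordinate (m := m) i).domain) =
      ⟨incl (𝓕⁻ (symbolS M (-p) (𝓕 Φ))), incl_mem_coordinate_domain i _⟩ :=
    Subtype.ext (momentumGroup_symm_incl M p Φ)
  change momentumGroup M p (coordinate i ⟨(momentumGroup M p).symm (incl Φ), h⟩) = _
  rw [h1, coordinate_incl, coordS_fourierInv, momentumGroup_incl, ← map_smul incl, ← map_sub incl]
  congr 1
  rw [FourierTransform.fourier_smul, FourierTransform.fourier_fourierInv_eq, lineDerivOp_symbolS,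
    map_smul, ← symbolS_add, add_neg_cancel, symbolS_zero, ← fourier_postcomp, smul_add,
    FourierTransform.fourierInv_add, ← FourierTransform.fourier_smul, ← FourierTransform.fourier_smul,
    FourierTransform.fourierInv_fourier_eq, FourierTransform.fourierInv_smul, ← coordS_fourierInv,
    FourierTransform.fourierInv_fourier_eq, sub_eq_add_neg, ← neg_smul, smul_smul]
  congr 2
  -- The inverse group element has parameter `-p`, so the coefficient is `(i/2π) · (2π p^i) · i =
  -- -p^i`.
  rw [phase_apply, EuclideanSpace.inner_single_right]
  simp
  field_simp
  rw [Complex.I_sq]; ring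

end AdjointAction

/-! ### Continuity and differentiability in `L²` of the group with `M = 1`. -/

section Translation

variable {n m : ℕ}

theorem smul_sub_self (c : ℂ) (v : Col m) : c • v - v = (c - 1) • v := by
  rw [sub_smul, one_smul]

theorem fourierInv_sub (f g : 𝓢(Pos n, Col m)) : 𝓕⁻ (f - g) = 𝓕⁻ f - 𝓕⁻ g := by
  rw [sub_eq_add_neg, FourierTransform.fourierInv_add, FourierTransform.fourierInv_neg,
    ← sub_eq_add_neg]

/-- For `M = 1` the symbol is a scalar phase, which reduces the operator estimates to inequalities
for `exp(it)`. -/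
theorem groupSymbol_one_apply (p ξ : Pos n) (v : Col m) :
    (groupSymbol (1 : selfAdjoint (Col m →L[ℂ] Col m)) p ξ : Col m →L[ℂ] Col m) v = Complex.exp (Complex.I * (phase p ξ : ℝ)) • v := by
  have : NormedAlgebra ℚ (Col m →L[ℂ] Col m) := .restrictScalars ℚ ℝ _
  have h : phase p ξ • Complex.I • ((1 : selfAdjoint (Col m →L[ℂ] Col m)) : Col m →L[ℂ] Col m) =
      algebraMap ℂ (Col m →L[ℂ] Col m) (Complex.I * (phase p ξ : ℝ)) := by
    rw [Algebra.algebraMap_eq_smul_one, mul_comm, mul_smul]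
    rfl
  rw [coe_groupSymbol, h, ← NormedSpace.algebraMap_exp_comm, Algebra.algebraMap_eq_smul_one,
    Complex.exp_eq_exp_ℂ]
  rfl

theorem momentumGroup_add_incl (M : selfAdjoint (Col m →L[ℂ] Col m)) (p q : Pos n)
    (Φ : 𝓢(Pos n, Col m)) :
    momentumGroup M (p + q) (incl Φ) = momentumGroup M p (momentumGroup M q (incl Φ)) := by
  rw [momentumGroup_incl, momentumGroup_incl, momentumGroup_incl,
    FourierTransform.fourier_fourierInv_eq, symbolS_add]

theorem norm_incl_fourierInv (g : 𝓢(Pos n, Col m)) : ‖incl (𝓕⁻ g)‖ = ‖incl g‖ := by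
  have h : 𝓕⁻ (incl g) = incl (𝓕⁻ g) := SchwartzMap.toLp_fourierInv_eq g
  rw [← h]
  exact (Lp.fourierTransformₗᵢ (Pos n) (Col m)).symm.norm_map _

/-- The weight `1 + ‖ξ‖²` as an operator on Schwartz functions. -/
def weightS : 𝓢(Pos n, Col m) →L[ℝ] 𝓢(Pos n, Col m) :=
  SchwartzMap.smulLeftCLM (Col m) (fun ξ : Pos n => 1 + ‖ξ‖ ^ 2)

theorem weightS_apply (g : 𝓢(Pos n, Col m)) (ξ : Pos n) :
    weightS g ξ = (1 + ‖ξ‖ ^ 2) • g ξ :=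
  SchwartzMap.smulLeftCLM_apply_apply
    ((Function.HasTemperateGrowth.const 1).add (Function.hasTemperateGrowth_norm_sq (Pos n))) g ξ

/-- One weight serves both Taylor estimates: `1 + ‖ξ‖²` dominates `‖ξ‖` in the first-order bound and
`‖ξ‖²` in the second-order remainder. -/
theorem norm_incl_le_of_weight {f g : 𝓢(Pos n, Col m)} {c : ℝ}
    (h : ∀ ξ, ‖f ξ‖ ≤ c * ((1 + ‖ξ‖ ^ 2) * ‖g ξ‖)) : ‖incl f‖ ≤ c * ‖incl (weightS g)‖ := by
  refine Lp.norm_le_mul_norm_of_ae_le_mul ?_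
  filter_upwards [coeFn_incl f, coeFn_incl (weightS g)] with ξ h1 h2
  rw [h1, h2, weightS_apply, norm_smul, Real.norm_of_nonneg (by positivity)]
  exact h ξ

theorem abs_phase_le (p ξ : Pos n) : |phase p ξ| ≤ 2 * Real.pi * (‖p‖ * ‖ξ‖) := by
  rw [phase_apply, abs_mul, abs_neg, abs_of_pos (by positivity : (0 : ℝ) < 2 * Real.pi)]
  gcongr
  exact abs_real_inner_le_norm p ξ

/-- For `|t| ≤ 1` this is the Taylor remainder; for `|t| ≥ 1` each of the two pieces is at most `|t|
≤ t²`. The constant is not sharp. -/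
theorem norm_exp_I_mul_sub_le (t : ℝ) :
    ‖Complex.exp (Complex.I * t) - 1 - Complex.I * t‖ ≤ 3 * t ^ 2 := by
  have hn : ‖Complex.I * (t : ℂ)‖ = |t| := by simp
  rcases le_total |t| 1 with h | h
  · have := Complex.norm_exp_sub_one_sub_id_le (x := Complex.I * t) (by rwa [hn])
    rw [hn, sq_abs] at this
    nlinarith [sq_nonneg t]
  · have h1 : ‖Complex.exp (Complex.I * t) - 1‖ ≤ |t| := by
      simpa using Real.norm_exp_I_mul_ofReal_sub_one_le (x := t)
    refine (norm_sub_le _ _).trans ?_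
    rw [hn, ← sq_abs]
    nlinarith

theorem norm_momentumGroup_one_sub_le (h : Pos n) (Ψ : 𝓢(Pos n, Col m)) :
    ‖momentumGroup 1 h (incl Ψ) - incl Ψ‖ ≤ 2 * Real.pi * ‖h‖ * ‖incl (weightS (𝓕 Ψ))‖ := by
  have e : momentumGroup 1 h (incl Ψ) - incl Ψ = incl (𝓕⁻ (symbolS 1 h (𝓕 Ψ) - 𝓕 Ψ)) := by
    rw [momentumGroup_incl, fourierInv_sub,
      FourierTransform.fourierInv_fourier_eq, map_sub]
  rw [e, norm_incl_fourierInv]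
  refine norm_incl_le_of_weight fun ξ => ?_
  rw [sub_apply, symbolS_apply, groupSymbol_one_apply, smul_sub_self, norm_smul, ← mul_assoc]
  gcongr
  have h1 : ‖Complex.exp (Complex.I * phase h ξ) - 1‖ ≤ |phase h ξ| := by
    simpa using Real.norm_exp_I_mul_ofReal_sub_one_le (x := phase h ξ)
  refine h1.trans ((abs_phase_le h ξ).trans ?_)
  rw [← mul_assoc]
  gcongr
  nlinarith [sq_nonneg (‖ξ‖ - 1), sq_nonneg ‖ξ‖]

theorem continuous_momentumGroup_one (Ψ : 𝓢(Pos n, Col m)) :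
    Continuous fun y : Pos n => momentumGroup 1 y (incl Ψ) := by
  refine continuous_iff_continuousAt.2 fun y => ?_
  rw [ContinuousAt, tendsto_iff_norm_sub_tendsto_zero]
  have hb : Tendsto (fun z : Pos n => 2 * Real.pi * ‖z - y‖ * ‖incl (weightS (𝓕 Ψ))‖) (𝓝 y) (𝓝 0) := by
    have : Continuous fun z : Pos n => 2 * Real.pi * ‖z - y‖ * ‖incl (weightS (𝓕 Ψ))‖ := by
      fun_prop
    simpa using this.tendsto y
  refine squeeze_zero (fun _ => norm_nonneg _) (fun z => ?_) hb
  have : momentumGroup 1 z (incl Ψ) = momentumGroup 1 y (momentumGroup 1 (z - y) (incl Ψ)) := by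
    rw [← momentumGroup_add_incl, add_sub_cancel]
  rw [this, ← map_sub, LinearIsometryEquiv.norm_map]
  exact norm_momentumGroup_one_sub_le _ _

/-- By Plancherel this is the second-order remainder of `exp(i · phase h ξ)`, since `-∂_h` has
Fourier symbol `i · phase h ξ`. -/
theorem norm_momentumGroup_one_sub_sub_le (h : Pos n) (Ψ : 𝓢(Pos n, Col m)) :
    ‖momentumGroup 1 h (incl Ψ) - incl Ψ - incl (-∂_{h} Ψ)‖ ≤
      3 * (2 * Real.pi * ‖h‖) ^ 2 * ‖incl (weightS (𝓕 Ψ))‖ := by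
  have e : momentumGroup 1 h (incl Ψ) - incl Ψ - incl (-∂_{h} Ψ) =
      incl (𝓕⁻ (symbolS 1 h (𝓕 Ψ) - 𝓕 Ψ - 𝓕 (-∂_{h} Ψ))) := by
    rw [momentumGroup_incl, fourierInv_sub, fourierInv_sub,
      FourierTransform.fourierInv_fourier_eq, FourierTransform.fourierInv_fourier_eq, map_sub,
      map_sub]
  have h1 : (fun ξ : Pos n => (inner ℝ ξ h : ℝ)).HasTemperateGrowth := by fun_prop
  rw [e, norm_incl_fourierInv]
  refine norm_incl_le_of_weight fun ξ => ?_
  have h2 : 𝓕 (-∂_{h} Ψ) ξ = (Complex.I * phase h ξ) • 𝓕 Ψ ξ := by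
    rw [FourierTransform.fourier_neg, SchwartzMap.fourier_lineDerivOp_eq, neg_apply, smul_apply,
      SchwartzMap.smulLeftCLM_apply_apply h1, phase_apply, ← Complex.coe_smul, smul_smul, ← neg_smul,
      real_inner_comm]
    congr 1
    push_cast; ring
  rw [sub_apply, sub_apply, symbolS_apply, groupSymbol_one_apply, h2, smul_sub_self, ← sub_smul,
    norm_smul, ← mul_assoc]
  gcongr
  refine (norm_exp_I_mul_sub_le _).trans ?_
  rw [mul_assoc]
  gcongr
  rw [← sq_abs]
  calc |phase h ξ| ^ 2 ≤ (2 * Real.pi * (‖h‖ * ‖ξ‖)) ^ 2 := by gcongr; exact abs_phase_le h ξ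
    _ = (2 * Real.pi * ‖h‖) ^ 2 * ‖ξ‖ ^ 2 := by ring
    _ ≤ _ := by gcongr; linarith

/-- The group law and the isometry property move the base point to the origin, where the remainder
is `O(t²)`. -/
theorem hasLineDerivAt_momentumGroup_one (Ψ : 𝓢(Pos n, Col m)) (e y : Pos n) :
    HasLineDerivAt ℝ (fun y : Pos n => momentumGroup 1 y (incl Ψ))
      (momentumGroup 1 y (incl (-∂_{e} Ψ))) y e := by
  rw [HasLineDerivAt, hasDerivAt_iff_isLittleO_nhds_zero]
  refine Asymptotics.IsBigO.trans_isLittleO (g := fun t : ℝ => t ^ 2) ?_ ?_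
  · refine Asymptotics.IsBigO.of_bound (3 * (2 * Real.pi * ‖e‖) ^ 2 * ‖incl (weightS (𝓕 Ψ))‖)
      (Eventually.of_forall fun t => ?_)
    have h := norm_momentumGroup_one_sub_sub_le (t • e) Ψ
    have h1 : t • momentumGroup 1 y (incl (-∂_{e} Ψ)) =
        momentumGroup 1 y (incl (-∂_{t • e} Ψ)) := by
      have h2 : -∂_{t • e} Ψ = (t : ℂ) • -∂_{e} Ψ := by
        rw [LineDeriv.lineDerivOp_left_smul, ← smul_neg]
        rfl
      rw [h2, map_smul, map_smul]
      rfl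
    rw [zero_add, zero_smul, add_zero, h1, momentumGroup_add_incl, ← map_sub, ← map_sub,
      LinearIsometryEquiv.norm_map]
    refine h.trans (le_of_eq ?_)
    rw [norm_smul, norm_pow]
    ring
  · exact Asymptotics.isLittleO_pow_id (by norm_num)

end Translation

/-! ### The deformed coordinates on Schwartz vectors and their commutator. -/

section Deformed

variable {n m : ℕ}

/-- The `i`-th row of `Θ` as a vector. -/
def rowVec (Θ : Matrix (Fin n) (Fin n) ℝ) (i : Fin n) : Pos n := WithLp.toLp 2 (Θ i)

theorem toEuclideanLin_apply_eq_inner (Θ : Matrix (Fin n) (Fin n) ℝ) (x : Pos n) (i : Fin n) :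
    Matrix.toEuclideanLin Θ x i = inner ℝ x (rowVec Θ i) := by
  rw [← sum_mul_eq_inner]
  change ∑ k, Θ i k * x k = _
  exact Finset.sum_congr rfl fun k _ => mul_comm (Θ i k) (x k)

theorem rowVec_eq_sum (Θ : Matrix (Fin n) (Fin n) ℝ) (i : Fin n) :
    rowVec Θ i = ∑ k, Θ i k • EuclideanSpace.single k (1 : ℝ) := by
  ext j
  simp [rowVec, Pi.single_apply]

theorem matS_lineDerivOp (M : Matrix (Fin m) (Fin m) ℂ) (e : Pos n) (Φ : 𝓢(Pos n, Col m)) :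
    ∂_{e} (matS M Φ) = matS M (∂_{e} Φ) := by
  ext1 x
  have h : HasFDerivAt (matS M Φ : Pos n → Col m)
      (((Matrix.toEuclideanCLM (n := Fin m) (𝕜 := ℂ) M).restrictScalars ℝ) ∘L fderiv ℝ Φ x) x :=
    ((Matrix.toEuclideanCLM (n := Fin m) (𝕜 := ℂ) M).restrictScalars ℝ).hasFDerivAt.comp x
      (Φ.hasFDerivAt x)
  rw [SchwartzMap.lineDerivOp_apply_eq_fderiv, h.fderiv]
  rfl

/-- The action of the deformed coordinate operator `X^i - (ΘP)^i ⊗ M` on Schwartz functions. -/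
def deformedS (Θ : Matrix (Fin n) (Fin n) ℝ) (M : Matrix (Fin m) (Fin m) ℂ) (i : Fin n)
    (Φ : 𝓢(Pos n, Col m)) : 𝓢(Pos n, Col m) :=
  coordS i Φ - ∑ k, (Θ i k : ℂ) • matS M (momS k Φ)

theorem sum_smul_momS (Θ : Matrix (Fin n) (Fin n) ℝ) (i : Fin n) (Φ : 𝓢(Pos n, Col m)) :
    ∑ k, (Θ i k : ℂ) • momS k Φ = Complex.I • ∂_{rowVec Θ i} Φ := by
  rw [rowVec_eq_sum, LineDeriv.lineDerivOp_left_sum, Finset.smul_sum]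
  refine Finset.sum_congr rfl fun k _ => ?_
  rw [LineDeriv.lineDerivOp_left_smul]
  exact smul_comm (Θ i k : ℂ) Complex.I (∂_{EuclideanSpace.single k (1 : ℝ)} Φ)

theorem deformedS_eq (Θ : Matrix (Fin n) (Fin n) ℝ) (M : Matrix (Fin m) (Fin m) ℂ) (i : Fin n)
    (Φ : 𝓢(Pos n, Col m)) :
    deformedS Θ M i Φ = coordS i Φ - Complex.I • matS M (∂_{rowVec Θ i} Φ) := by
  rw [deformedS, ← map_smul (matS M), ← sum_smul_momS, map_sum]
  simp only [map_smul]

/-- Since `(Θx)^i = ⟨x, r⟩` for `r` the `i`-th row, the conjugated coordinate splits into an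
unweighted and a linearly weighted oscillatory integrand. -/
theorem warpedIntegrand_coordinate (Θ : Matrix (Fin n) (Fin n) ℝ) (M : Matrix (Fin m) (Fin m) ℂ)
    (hM : M.IsHermitian) (i : Fin n) (Φ : 𝓢(Pos n, Col m)) (χ : 𝓢(Pos n × Pos n, ℂ)) (ε : ℝ)
    (hΦ : ∀ x, incl Φ ∈ (adjointAction (momentumGroup (hermitianOp M hM)
      (Matrix.toEuclideanLin Θ x)) (coordinate i)).domain) (z : Pos n × Pos n) :
    warpedIntegrand (momentumGroup 1) (momentumGroup (hermitianOp M hM)) Θ (coordinate i)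
      (incl Φ) hΦ χ ε z =
      osc χ ε (fun y => momentumGroup 1 y (incl (coordS i Φ))) z -
        ((inner ℝ z.1 (rowVec Θ i) : ℝ) : ℂ) •
          osc χ ε (fun y => momentumGroup 1 y (incl (matS M Φ))) z := by
  simp only [warpedIntegrand, osc]
  rw [adjointAction_coordinate_incl, toEuclideanLin_apply_eq_inner, sum_mul_eq_inner]
  generalize χ (ε • z) * Complex.exp (-Complex.I * ((inner ℝ z.1 z.2 : ℝ) : ℂ)) = c
  generalize ((inner ℝ z.1 (rowVec Θ i) : ℝ) : ℂ) = d
  rw [map_sub, map_smul, smul_sub, smul_comm c d]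
  rfl

theorem momentumGroup_zero_incl (M : selfAdjoint (Col m →L[ℂ] Col m)) (Φ : 𝓢(Pos n, Col m)) :
    momentumGroup M 0 (incl Φ) = incl Φ := by
  rw [momentumGroup_incl, symbolS_zero, FourierTransform.fourierInv_fourier_eq]

theorem norm_momentumGroup_incl_le (M : selfAdjoint (Col m →L[ℂ] Col m)) (Φ : 𝓢(Pos n, Col m))
    (y : Pos n) : ‖momentumGroup M y (incl Φ)‖ ≤ ‖incl Φ‖ :=
  (LinearIsometryEquiv.norm_map _ _).le

theorem isWarpedValue_coordinate (Θ : Matrix (Fin n) (Fin n) ℝ) (M : Matrix (Fin m) (Fin m) ℂ)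
    (hM : M.IsHermitian) (i : Fin n) (Φ : 𝓢(Pos n, Col m)) :
    IsWarpedValue (momentumGroup 1) (momentumGroup (hermitianOp M hM)) Θ (coordinate i)
      (incl Φ) (incl (deformedS Θ M i Φ)) := by
  refine ⟨fun x => incl_mem_adjointAction_domain _ _ i Φ, fun χ hχ => ?_⟩
  have h := tendsto_integral_osc_sub_inner_smul_osc χ hχ
    (continuous_momentumGroup_one (coordS i Φ)) (norm_momentumGroup_incl_le 1 (coordS i Φ))
    (continuous_momentumGroup_one (matS M Φ)) (norm_momentumGroup_incl_le 1 (matS M Φ))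
    (continuous_momentumGroup_one (-∂_{rowVec Θ i} (matS M Φ)))
    (norm_momentumGroup_incl_le 1 _) (rowVec Θ i)
    (fun y => hasLineDerivAt_momentumGroup_one _ _ y)
    (fun ε z => warpedIntegrand_coordinate Θ M hM i Φ χ ε
      (fun x => incl_mem_adjointAction_domain _ _ i Φ) z)
  -- The limit is `F(0) + i ∂_r G(0)`, and translation gives `∂_r G(0) = -∂_r (M Φ)`.
  have hv : coordS i Φ + Complex.I • -∂_{rowVec Θ i} (matS M Φ) = deformedS Θ M i Φ := by
    rw [deformedS_eq, smul_neg, ← sub_eq_add_neg, matS_lineDerivOp]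
  rwa [momentumGroup_zero_incl, momentumGroup_zero_incl, ← map_smul incl, ← map_add incl, hv] at h

theorem incl_mem_deformedCoordinate_domain (Θ : Matrix (Fin n) (Fin n) ℝ)
    (M : Matrix (Fin m) (Fin m) ℂ) (hM : M.IsHermitian) (i : Fin n) (Φ : 𝓢(Pos n, Col m)) :
    incl Φ ∈ (deformedCoordinate Θ M hM i).domain :=
  ⟨_, isWarpedValue_coordinate Θ M hM i Φ⟩

theorem deformedCoordinate_incl (Θ : Matrix (Fin n) (Fin n) ℝ)
    (M : Matrix (Fin m) (Fin m) ℂ) (hM : M.IsHermitian) (i : Fin n) (Φ : 𝓢(Pos n, Col m))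
    (h : incl Φ ∈ (deformedCoordinate Θ M hM i).domain) :
    deformedCoordinate Θ M hM i ⟨incl Φ, h⟩ = incl (deformedS Θ M i Φ) :=
  warpedConvolution_apply (isWarpedValue_coordinate Θ M hM i Φ)

theorem lineDerivOp_coordS (i : Fin n) (e : Pos n) (Φ : 𝓢(Pos n, Col m)) :
    ∂_{e} (coordS i Φ) = coordS i (∂_{e} Φ) + (e i : ℂ) • Φ := by
  ext1 x
  have h1 : HasDerivAt (fun t : ℝ => (((x + t • e) i : ℝ) : ℂ)) (e i : ℂ) 0 := by
    have h : HasDerivAt (fun t : ℝ => x i + t * e i) (e i) 0 := by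
      simpa using ((hasDerivAt_id (0 : ℝ)).mul_const (e i)).const_add (x i)
    exact h.ofReal_comp
  have h3 : HasDerivAt (fun t : ℝ => Φ (x + t • e)) ((∂_{e} Φ) x) 0 := by
    have h0 : HasDerivAt (fun t : ℝ => x + t • e) e 0 := by
      simpa using ((hasDerivAt_id (0 : ℝ)).smul_const e).const_add x
    have h := (Φ.hasFDerivAt (x + (0 : ℝ) • e)).comp_hasDerivAt (0 : ℝ) h0
    rwa [zero_smul, add_zero, ← SchwartzMap.lineDerivOp_apply_eq_fderiv] at h
  rw [SchwartzMap.lineDerivOp_apply, lineDeriv]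
  simp only [coordS_apply]
  refine (h1.smul h3).deriv.trans ?_
  simp [coordS_apply]

theorem coordS_matS (M : Matrix (Fin m) (Fin m) ℂ) (i : Fin n) (Φ : 𝓢(Pos n, Col m)) :
    coordS i (matS M Φ) = matS M (coordS i Φ) := by
  ext1 x
  change _ = Matrix.toEuclideanCLM (n := Fin m) (𝕜 := ℂ) M (coordS i Φ x)
  rw [coordS_apply, coordS_apply, map_smul]
  rfl

theorem coordS_comm (i j : Fin n) (Φ : 𝓢(Pos n, Col m)) :
    coordS i (coordS j Φ) = coordS j (coordS i Φ) := by
  ext1 x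
  simp only [coordS_apply]
  rw [smul_comm]

/-- Symmetry of the second derivative of a smooth function. -/
theorem lineDerivOp_comm (v w : Pos n) (Φ : 𝓢(Pos n, Col m)) :
    ∂_{v} (∂_{w} Φ) = ∂_{w} (∂_{v} Φ) := by
  have h (g : 𝓢(Pos n, Col m)) (a b : Pos n) (x : Pos n) :
      (∂_{a} (∂_{b} g)) x = fderiv ℝ (fderiv ℝ g) x a b := by
    have hd : DifferentiableAt ℝ (fderiv ℝ g) x :=
      ((g.smooth 2).fderiv_right (m := 1) (by norm_num)).differentiable one_ne_zero x
    rw [SchwartzMap.lineDerivOp_apply_eq_fderiv]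
    change fderiv ℝ (fun y => fderiv ℝ g y b) x a = _
    rw [fderiv_clm_apply hd (differentiableAt_const b)]
    simp
  ext1 x
  rw [h, h]
  exact ((Φ.smooth 2).contDiffAt.isSymmSndFDerivAt (by simp)) v w

theorem deformedS_commutator (Θ : Matrix (Fin n) (Fin n) ℝ) (hΘ : Θ.transpose = -Θ)
    (M : Matrix (Fin m) (Fin m) ℂ) (i j : Fin n) (Φ : 𝓢(Pos n, Col m)) :
    deformedS Θ M i (deformedS Θ M j Φ) - deformedS Θ M j (deformedS Θ M i Φ) =
      (-2 * Complex.I * (Θ i j : ℂ)) • matS M Φ := by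
  have hs : Θ j i = -Θ i j := congrFun (congrFun hΘ i) j
  have hsub (v : Pos n) (f g : 𝓢(Pos n, Col m)) : ∂_{v} (f - g) = ∂_{v} f - ∂_{v} g := by
    rw [sub_eq_add_neg, LineDeriv.lineDerivOp_add, LineDeriv.lineDerivOp_neg, ← sub_eq_add_neg]
  have hrow (k l : Fin n) : rowVec Θ k l = Θ k l := rfl
  simp only [deformedS_eq, map_sub, map_add, map_smul, hsub, LineDeriv.lineDerivOp_smul,
    lineDerivOp_coordS, matS_lineDerivOp, coordS_matS, hrow, hs, smul_sub, smul_add]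
  -- The terms `x^i x^j` and `M² ∂∂` cancel by these symmetries. What remains is `i Θ^{ji} M - i
  -- Θ^{ij} M`, which is `-2i Θ^{ij} M` by skew-symmetry.
  rw [coordS_comm i j, lineDerivOp_comm (rowVec Θ i) (rowVec Θ j)]
  push_cast
  module

end Deformed

end MoyalWeyl

end

/-! ### The main theorem. -/

open MoyalWeyl
theorem mainTheorem2 {n m : ℕ} (Θ : Matrix (Fin n) (Fin n) ℝ) (hΘ : Θ.transpose = -Θ)
    (τ : Fin (m ^ 2 - 1) → Matrix (Fin m) (Fin m) ℂ) (hτ : IsSUGenerators τ)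
    (Y : Fin (m ^ 2 - 1) → Matrix (Fin m) (Fin m) ℂ)
    (M : Matrix (Fin m) (Fin m) ℂ) (hM : M = ∑ α, Y α * τ α) (hH : M.IsHermitian) :
    (∀ (i : Fin n) (Φ : SchwartzMap (Pos n) (Col m)),
      ∃ h : incl Φ ∈ (deformedCoordinate Θ M hH i).domain,
        deformedCoordinate Θ M hH i ⟨incl Φ, h⟩ =
          incl (coordS i Φ - ∑ k, (Θ i k : ℂ) • matS M (momS k Φ))) ∧
    (∀ (i j : Fin n) (Φ : SchwartzMap (Pos n) (Col m)),
      ∃ (hi : incl Φ ∈ (deformedCoordinate Θ M hH i).domain)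
        (hj : incl Φ ∈ (deformedCoordinate Θ M hH j).domain)
        (hij : deformedCoordinate Θ M hH j ⟨incl Φ, hj⟩ ∈ (deformedCoordinate Θ M hH i).domain)
        (hji : deformedCoordinate Θ M hH i ⟨incl Φ, hi⟩ ∈ (deformedCoordinate Θ M hH j).domain),
        deformedCoordinate Θ M hH i ⟨deformedCoordinate Θ M hH j ⟨incl Φ, hj⟩, hij⟩ -
            deformedCoordinate Θ M hH j ⟨deformedCoordinate Θ M hH i ⟨incl Φ, hi⟩, hji⟩ =
          incl ((-2 * Complex.I * (Θ i j : ℂ)) • matS M Φ)) := by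
  refine ⟨fun i Φ => ⟨incl_mem_deformedCoordinate_domain Θ M hH i Φ,
    deformedCoordinate_incl Θ M hH i Φ _⟩, fun i j Φ => ?_⟩
  -- A deformed coordinate sends a Schwartz vector to a Schwartz vector, so a second one can be
  -- applied.
  have hd (k l : Fin n) (h : incl Φ ∈ (deformedCoordinate Θ M hH l).domain) :
      deformedCoordinate Θ M hH l ⟨incl Φ, h⟩ ∈ (deformedCoordinate Θ M hH k).domain := by
    rw [deformedCoordinate_incl]
    exact incl_mem_deformedCoordinate_domain Θ M hH k _
  have he (k l : Fin n) (h : incl Φ ∈ (deformedCoordinate Θ M hH l).domain) :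
      deformedCoordinate Θ M hH k ⟨deformedCoordinate Θ M hH l ⟨incl Φ, h⟩, hd k l h⟩ =
        incl (deformedS Θ M k (deformedS Θ M l Φ)) := by
    rw [← deformedCoordinate_incl Θ M hH k _ (incl_mem_deformedCoordinate_domain Θ M hH k _)]
    congr 2
    exact deformedCoordinate_incl Θ M hH l Φ h
  refine ⟨incl_mem_deformedCoordinate_domain Θ M hH i Φ,
    incl_mem_deformedCoordinate_domain Θ M hH j Φ, hd i j _, hd j i _, ?_⟩
  rw [he, he, ← map_sub, deformedS_commutator Θ hΘ]
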